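/- **Theorem (TSPP $\le_m^p$ ORDER).** Consider the following two decision problems. TSPP. *Instance:* an undirected simple graph $G=(V,E)$ on a nonempty finite vertex set, with rational edge weights $w:E\to\mathbb{Q}$, and a constant $C\in\mathbb{Q}$. *Question:* does $G$ have a Hamiltonian path whose weight (the sum of the weights of its edges) is at most $C$? ORDER. *Instance:* a Markov chain with nonempty finite state set $\{1,\dots,N\}$, given by a row-stochastic matrix $T\in\mathbb{Q}_{+}^{N\times N}$ and started from the uniform distribution, a finite sequence $X$ of states, and a constant $p\in\mathbb{Q}$. *Question:* is there a permutation $(y_1,\dots,y_m)$ of $X$ that the chain generates with probability at least $p$, i.e. $\frac1N\prod_{t=2}^m T_{y_{t-1}y_t}\ge p$ (the empty sequence has probability $1$)? All rational numbers are encoded as pairs of binary integers (numerator and denominator, not necessarily in lowest terms), graphs and chains by their (weight, resp. transition) matrices. (1) There is a polynomial-time many-one reduction from TSPP to ORDER: a map from instances of TSPP to instances of ORDER that is computable by a Turing machine in time polynomial in the length of the encoding and under which an instance of TSPP has the answer "yes" if and only if its image has. (2) Let $G=(V,E)$ be an undirected simple graph with $n=|V|\ge 1$, having at least one edge if $n\ge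 2$, with real edge weights $w$, and let $C\in\mathbb{R}$. Put $\Delta=\max_{i\in V}\sum_{j:\,ij\in E}\exp(-w(ij))$ and $$T_{ij}=\begin{cases}\exp(-w(ij))/\Delta,& ij\in E,\\ 0,& i\ne j,\ ij\notin E,\end{cases}\qquad T_{ii}=1-\sum_{j\ne i}T_{ij},\qquad p=\frac{\exp(-C)}{n\,\Delta^{\,n-1}}$$ (for $n=1$: $T=(1)$ and $p=\exp(-C)$). Then $T$ is row-stochastic, and $G$ has a Hamiltonian path of weight at most $C$ if and only if some permutation $(y_1,\dots,y_n)$ of $V$ is generated by the Markov chain with transition matrix $T$ and uniform initial distribution with probability $\frac1n\prod_{t=2}^nT_{y_{t-1}y_t}\ge p$. -/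

import Mathlib

open Computability

noncomputable section

namespace TSPPOrder

/-! ### Decision problems and polynomial-time many-one reductions -/

/-- A decision problem: a type of instances, written injectively as words over Mathlib's standard
finite Turing machine alphabet `Γ'` (the symbols blank, bit 0, bit 1, bra, ket, comma), together
with the set of instances whose answer is "yes". -/
structure DecisionProblem where
  /-- the instances -/
  Inst : Type
  /-- the word that represents an instance -/
  encode : Inst → List Γ'
  /-- distinct instances are represented by distinct words -/
  encode_injective : Function.Injective encode
  /-- the answer to the instance is "yes" -/
  Yes : Inst → Prop

/-- `A ≤ₘᵖ B`: some map of instances preserves and reflects the answer "yes" and is computed by a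
(multi-stack) Turing machine whose number of steps is bounded by a polynomial in the length of
the input word. -/
def PolyTimeReducible (A B : DecisionProblem) : Prop :=
  ∃ f : A.Inst → B.Inst,
    Nonempty (Turing.TM2ComputableInPolyTime A.encode B.encode f) ∧
      ∀ x, A.Yes x ↔ B.Yes (f x)

/-! ### Encodings -/

/-- A fraction of integers with positive denominator, not necessarily in lowest terms. -/
abbrev Frac : Type := ℤ × ℕ+

/-- The rational number denoted by a fraction. -/
def Frac.val (q : Frac) : ℚ := (q.1 : ℚ) / ((q.2 : ℕ) : ℚ)

/-- A self-delimiting encoding: the encoded object can be read off the front of a word. -/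
def SelfDelim {α : Type} (e : α → List Γ') : Prop :=
  ∀ (a b : α) (s t : List Γ'), e a ++ s = e b ++ t → a = b ∧ s = t

theorem SelfDelim.injective {α : Type} {e : α → List Γ'} (h : SelfDelim e) :
    Function.Injective e := fun a b hab => (h a b [] [] (by simpa using hab)).1

/-- Binary expansion, least significant bit first, followed by an end marker. -/
def encNat (n : ℕ) : List Γ' := n.bits.map Γ'.bit ++ [Γ'.comma]

/-- Unary expansion, followed by an end marker. -/
def encUnary (n : ℕ) : List Γ' := List.replicate n (Γ'.bit true) ++ [Γ'.ket]

/-- A sign bit, then numerator and denominator in binary. -/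
def encFrac (q : Frac) : List Γ' :=
  Γ'.bit (decide (q.1 < 0)) :: (encNat q.1.natAbs ++ encNat (q.2 : ℕ))

/-- `none` is written as a blank. -/
def encOptFrac : Option Frac → List Γ'
  | none => [Γ'.blank]
  | some q => encFrac q

/-- The entries of a vector, in order. -/
def encVec {α : Type} (e : α → List Γ') {n : ℕ} (f : Fin n → α) : List Γ' :=
  (List.finRange n).flatMap fun i => e (f i)

/-- The entries of a square matrix, row by row. -/
def encMat {α : Type} (e : α → List Γ') {n : ℕ} (A : Fin n → Fin n → α) : List Γ' :=
  encVec (encVec e) A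

/-- A list of indices: each index is written as a comma followed by its unary expansion, and the
whole list is closed by an end marker. -/
def encIndices {n : ℕ} : List (Fin n) → List Γ'
  | [] => [Γ'.ket]
  | i :: l => Γ'.comma :: (encUnary i ++ encIndices l)

theorem selfDelim_encNat : SelfDelim encNat := by
  have key : ∀ (k l : List Bool) (s t : List Γ'),
      (k.map Γ'.bit ++ [Γ'.comma]) ++ s = (l.map Γ'.bit ++ [Γ'.comma]) ++ t →
        k = l ∧ s = t := by
    intro k
    induction k with
    | nil => intro l s t h; cases l <;> simp_all
    | cons b k ih =>
      intro l s t h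
      cases l with
      | nil => simp at h
      | cons c l =>
        simp only [List.map_cons, List.cons_append, List.cons.injEq, Γ'.bit.injEq] at h
        obtain ⟨h1, h2⟩ := ih l s t h.2
        exact ⟨by rw [h.1, h1], h2⟩
  intro a b s t h
  obtain ⟨h1, h2⟩ := key _ _ _ _ h
  refine ⟨Nat.digits.injective 2 ?_, h2⟩
  rw [Nat.digits_two_eq_bits, Nat.digits_two_eq_bits, h1]

theorem selfDelim_encUnary : SelfDelim encUnary := by
  intro a
  induction a with
  | zero => intro b s t h; cases b <;> simp_all [encUnary, List.replicate_succ]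
  | succ a ih =>
    intro b s t h
    cases b with
    | zero => simp [encUnary, List.replicate_succ] at h
    | succ b =>
      obtain ⟨h1, h2⟩ := ih b s t (by simpa [encUnary, List.replicate_succ] using h)
      exact ⟨by rw [h1], h2⟩

theorem selfDelim_encFrac : SelfDelim encFrac := by
  rintro ⟨a, d⟩ ⟨b, e⟩ s t h
  simp only [encFrac, List.cons_append, List.append_assoc, List.cons.injEq, Γ'.bit.injEq,
    decide_eq_decide] at h
  obtain ⟨h0, h⟩ := h
  obtain ⟨h1, h⟩ := selfDelim_encNat _ _ _ _ h
  obtain ⟨h2, h⟩ := selfDelim_encNat _ _ _ _ h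
  have hab : a = b := by omega
  exact ⟨by rw [hab, PNat.coe_injective h2], h⟩

theorem selfDelim_encOptFrac : SelfDelim encOptFrac := by
  intro a b s t h
  cases a with
  | none =>
    cases b with
    | none => simpa [encOptFrac] using h
    | some b => simp [encOptFrac, encFrac] at h
  | some a =>
    cases b with
    | none => simp [encOptFrac, encFrac] at h
    | some b =>
      obtain ⟨h1, h2⟩ := selfDelim_encFrac a b s t h
      exact ⟨by rw [h1], h2⟩

theorem selfDelim_encVec {α : Type} {e : α → List Γ'} (he : SelfDelim e) (n : ℕ) :
    SelfDelim (encVec e : (Fin n → α) → List Γ') := by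
  have key : ∀ (l : List (Fin n)) (f g : Fin n → α) (s t : List Γ'),
      (l.flatMap fun i => e (f i)) ++ s = (l.flatMap fun i => e (g i)) ++ t →
        (∀ i ∈ l, f i = g i) ∧ s = t := by
    intro l f g
    induction l with
    | nil => intro s t h; simpa using h
    | cons i l ih =>
      intro s t h
      simp only [List.flatMap_cons, List.append_assoc] at h
      obtain ⟨h1, h⟩ := he _ _ _ _ h
      obtain ⟨h2, h⟩ := ih _ _ h
      exact ⟨by simpa [h1] using h2, h⟩
  intro f g s t h
  obtain ⟨h1, h2⟩ := key _ f g s t h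
  exact ⟨funext fun i => h1 i (List.mem_finRange i), h2⟩

theorem selfDelim_encMat {α : Type} {e : α → List Γ'} (he : SelfDelim e) (n : ℕ) :
    SelfDelim (encMat e : (Fin n → Fin n → α) → List Γ') :=
  selfDelim_encVec (selfDelim_encVec he n) n

theorem selfDelim_encIndices (n : ℕ) : SelfDelim (encIndices : List (Fin n) → List Γ') := by
  intro a
  induction a with
  | nil => intro b s t h; cases b <;> simp_all [encIndices]
  | cons i a ih =>
    intro b s t h
    cases b with
    | nil => simp [encIndices] at h
    | cons j b =>
      simp only [encIndices, List.cons_append, List.append_assoc, List.cons.injEq,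
        true_and] at h
      obtain ⟨h1, h⟩ := selfDelim_encUnary _ _ _ _ h
      obtain ⟨h2, h⟩ := ih _ _ _ h
      exact ⟨by rw [Fin.ext h1, h2], h⟩

/-! ### The traveling salesman path problem -/

/-- The weight of a walk: the sum of the weights of its edges. -/
def walkWeight {V R : Type*} [AddCommMonoid R] {G : SimpleGraph V} (w : G.edgeSet → R)
    {u v : V} (q : G.Walk u v) : R :=
  (q.edges.attach.map fun e => w ⟨e.1, q.edges_subset_edgeSet e.2⟩).sum

/-- The weighted graph has a Hamiltonian path of weight at most `C`. -/
def HasHamiltonianPath {V R : Type*} [DecidableEq V] [AddCommMonoid R] [LE R]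
    {G : SimpleGraph V} (w : G.edgeSet → R) (C : R) : Prop :=
  ∃ (u v : V) (q : G.Walk u v), q.IsHamiltonian ∧ walkWeight w q ≤ C

/-- An instance of TSPP: an undirected graph on a nonempty vertex set `{0, …, n - 1}` with rational
edge weights, and a rational constant `C`. -/
structure TSPPInstance where
  /-- the number of vertices -/
  n : ℕ
  n_pos : 0 < n
  /-- the graph -/
  G : SimpleGraph (Fin n)
  /-- the edge weights -/
  w : G.edgeSet → Frac
  /-- the bound on the weight of the path -/
  C : Frac

open scoped Classical in
/-- The weighted adjacency matrix; `none` stands for "no edge". -/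
def weightMatrix {n : ℕ} (G : SimpleGraph (Fin n)) (w : G.edgeSet → Frac) (i j : Fin n) :
    Option Frac :=
  if h : G.Adj i j then some (w ⟨s(i, j), h⟩) else none

/-- The number of vertices in unary (the matrix that follows is longer than that), the weighted
adjacency matrix and the bound, all weights in binary. -/
def TSPPInstance.encode (I : TSPPInstance) : List Γ' :=
  encUnary I.n ++ (encMat encOptFrac (weightMatrix I.G I.w) ++ encFrac I.C)

theorem TSPPInstance.encode_injective : Function.Injective TSPPInstance.encode := by
  rintro ⟨n, hn, G, w, C⟩ ⟨n', hn', G', w', C'⟩ h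
  simp only [TSPPInstance.encode] at h
  obtain ⟨h1, h⟩ := selfDelim_encUnary _ _ _ _ h
  subst h1
  obtain ⟨h2, h⟩ := selfDelim_encMat selfDelim_encOptFrac _ _ _ _ _ h
  have h3 := selfDelim_encFrac.injective h
  have hG : G = G' := by
    ext i j
    have := congrFun (congrFun h2 i) j
    by_cases ha : G.Adj i j <;> by_cases hb : G'.Adj i j <;> simp_all [weightMatrix]
  subst hG
  have hw : w = w' := by
    funext e
    obtain ⟨e, he⟩ := e
    induction e with
    | _ i j =>
      have hij : G.Adj i j := he
      have := congrFun (congrFun h2 i) j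
      simpa [weightMatrix, hij] using this
  rw [hw, h3]

/-- The traveling salesman path problem: is there a Hamiltonian path of weight at most `C`? -/
def TSPP : DecisionProblem where
  Inst := TSPPInstance
  encode := TSPPInstance.encode
  encode_injective := TSPPInstance.encode_injective
  Yes I := HasHamiltonianPath (fun e => (I.w e).val) I.C.val

/-! ### The optimal order problem in a Markov chain -/

/-- The product of the transition probabilities along a sequence that starts in a given state. -/
def transProd {S K : Type*} [Field K] (T : Matrix S S K) : S → List S → K
  | _, [] => 1
  | a, b :: l => T a b * transProd T b l

/-- The probability that the Markov chain with transition matrix `T` and uniform initial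
distribution generates a given sequence of states (as its first states). -/
def genProb {S K : Type*} [Fintype S] [Field K] (T : Matrix S S K) : List S → K
  | [] => 1
  | a :: l => (Fintype.card S : K)⁻¹ * transProd T a l

/-- Some permutation of the sequence `X` is generated with probability at least `p`. -/
def HasOrder {S K : Type*} [Fintype S] [Field K] [LE K] (T : Matrix S S K) (X : List S)
    (p : K) : Prop :=
  ∃ Y : List S, Y.Perm X ∧ p ≤ genProb T Y

/-- An instance of ORDER: a Markov chain on a nonempty state space `{0, …, n - 1}`, given by a
row-stochastic matrix of rational transition probabilities, a finite sequence of states `X` and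
a rational constant `p`. -/
structure OrderInstance where
  /-- the number of states -/
  n : ℕ
  n_pos : 0 < n
  /-- the transition probabilities -/
  T : Fin n → Fin n → Frac
  stochastic : (Matrix.of fun i j => (T i j).val) ∈ Matrix.rowStochastic ℚ (Fin n)
  /-- the sequence of states -/
  X : List (Fin n)
  /-- the threshold -/
  p : Frac

/-- The number of states in unary (the matrix that follows is longer than that), the transition
matrix with entries in binary, the sequence of states and the threshold in binary. -/
def OrderInstance.encode (I : OrderInstance) : List Γ' :=
  encUnary I.n ++ (encMat encFrac I.T ++ (encIndices I.X ++ encFrac I.p))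

theorem OrderInstance.encode_injective : Function.Injective OrderInstance.encode := by
  rintro ⟨n, hn, T, hT, X, p⟩ ⟨n', hn', T', hT', X', p'⟩ h
  simp only [OrderInstance.encode] at h
  obtain ⟨h1, h⟩ := selfDelim_encUnary _ _ _ _ h
  subst h1
  obtain ⟨h2, h⟩ := selfDelim_encMat selfDelim_encFrac _ _ _ _ _ h
  obtain ⟨h3, h⟩ := selfDelim_encIndices _ _ _ _ _ h
  have h4 := selfDelim_encFrac.injective h
  subst h2 h3 h4
  rfl

/-- The optimal order problem: is some permutation of `X` generated with probability at
least `p`? -/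
def ORDER : DecisionProblem where
  Inst := OrderInstance
  encode := OrderInstance.encode
  encode_injective := OrderInstance.encode_injective
  Yes I := HasOrder (Matrix.of fun i j => (I.T i j).val) I.X I.p.val

/-! ### The Markov chain of a weighted graph -/

section Chain

variable {V : Type*} [Fintype V]

open scoped Classical in
/-- `exp (-w(e))` for the edge `e = {i, j}`, and `0` if there is no such edge. -/
def expWeight {G : SimpleGraph V} (w : G.edgeSet → ℝ) (i j : V) : ℝ :=
  if h : G.Adj i j then Real.exp (-w ⟨s(i, j), h⟩) else 0

/-- `Δ`, the maximum over the vertices `i` of the sum of `exp (-w(e))` over the edges `e` at `i`. -/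
def expDelta [Nonempty V] {G : SimpleGraph V} (w : G.edgeSet → ℝ) : ℝ :=
  Finset.univ.sup' Finset.univ_nonempty fun i => ∑ j, expWeight w i j

/-- The transition matrix: `exp (-w(e)) / Δ` along an edge `e`, `0` between distinct vertices that
are not adjacent, and self-loops that complete each row. -/
def expChain [Nonempty V] [DecidableEq V] {G : SimpleGraph V} (w : G.edgeSet → ℝ) :
    Matrix V V ℝ :=
  Matrix.of fun i j =>
    if i = j then 1 - ∑ k ∈ Finset.univ.erase i, expWeight w i k / expDelta w
    else expWeight w i j / expDelta w

/-- The threshold `exp (-C) / (n Δ ^ (n - 1))`, where `n` is the number of vertices. -/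
def expThreshold [Nonempty V] {G : SimpleGraph V} (w : G.edgeSet → ℝ) (C : ℝ) : ℝ :=
  Real.exp (-C) / (Fintype.card V * expDelta w ^ (Fintype.card V - 1))

end Chain

end TSPPOrder

end

/-!
Part two is a computation: along a sequence of distinct vertices the transition probabilities are
`exp (-w) / Δ` on edges and `0` elsewhere, so an arrangement of the vertices has positive
probability exactly when it is a Hamiltonian path, and the probability is then a decreasing function
of the weight (`hasHamiltonianPath_iff_hasOrder`).

Part one cannot use this chain, whose entries are irrational. Since only the sign of the sum of
`-C` and the weights of the path matters, it suffices to replace `exp (-ε w)`, for a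
tiny `ε`, by a rational function with the same linear part. With `M = 2 ^ m` this is
`factor M w = 1 - w / (2 M + |w|)`. If all weights are at most `2 ^ L` in absolute value and have a
common denominator at most `2 ^ L`, where `L` is the length of the input, then `m = 6 L`
separates products of factors that belong to nonpositive sums from those that belong to positive
sums by the threshold `1 - 2 ^ (-8 L)` (`le_prod_factor_iff`).

The chain is designed so that a Turing machine can write it down without arithmetic. Every vertex `i`
becomes a state `2 i`, accompanied by a sink `2 i + 1`, and an additional vertex `n`, which no
transition enters, has edges of weight `-C` to all others; it therefore comes first in every order
of positive probability, and the threshold does not depend on `C`. Column `j` of the graph has total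
probability `2 ^ (-(j + 1))` in every row, shared by the vertex and its sink. As every vertex `j < n`
is entered exactly once, these scale factors multiply to a constant. For a weight `± a / b` the two
shares are `M b / D` and `(M b + a) / D` with `D = 2 ^ (j + 1) (2 M b + a)`, the vertex having the
larger one if the weight is negative and the smaller one otherwise. With least significant bits
first, all these numbers are concatenations of strings of zeros, the bits of `a` and the bits of `b`
(`bitWord_pow_mul_add`), and the numerator of the threshold is a string of ones. The only arithmetic
that remains is to convert the number of states from unary to binary.

The machine is written in a small structured language (`Cmd`) with a big-step semantics that counts
steps (`Run`), and compiled to Mathlib's stack machines (`Run.stepsTo`, `polyTime_of_run`). Its parts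
are specified as transducers (`Trans`): they consume a prefix of the input, extend the output, and
change the other stacks in a described way. The program and its running time are the subject of
`exists_run_reduction`, the correctness of the reduction that of `TSPPInstance.yes_iff`.
-/

noncomputable section

namespace TSPPOrder

/-! ### A structured language for stack machines -/

/-- Programs over a family of stacks with alphabet `Γ'` and one register, which holds the result of
the last `pop` (`none` if the stack was empty). -/
inductive Cmd (K : Type) : Type
  /-- push the symbols of a fixed word one after the other -/
  | put (k : K) (l : List Γ')
  /-- push the content of the register (a blank if it is `none`) -/
  | copy (k : K)
  /-- pop a stack into the register -/
  | pop (k : K)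
  /-- run one program after the other -/
  | seq (c d : Cmd K)
  /-- branch on the register -/
  | ite (p : Option Γ' → Bool) (c d : Cmd K)
  /-- pop a stack into the register; as long as the register satisfies the test, run the body and
  pop again -/
  | loop (k : K) (p : Option Γ' → Bool) (c : Cmd K)

infixr:60 " ;; " => Cmd.seq

section Language

variable {K : Type} [DecidableEq K]

/-- `Run c r s r' s' t`: started with register `r` and stacks `s`, the program `c` ends with
register `r'` and stacks `s'` after at most `t` steps. -/
inductive Run : Cmd K → Option Γ' → (K → List Γ') → Option Γ' → (K → List Γ') → ℕ → Prop
  | put {k l r s t} : 1 ≤ t → Run (.put k l) r s r (Function.update s k (l.reverse ++ s k)) t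
  | copy {k r s t} : 1 ≤ t →
      Run (.copy k) r s r (Function.update s k (r.getD Γ'.blank :: s k)) t
  | pop {k r s t} : 1 ≤ t → Run (.pop k) r s (s k).head? (Function.update s k (s k).tail) t
  | seq {c d r s r₁ s₁ r₂ s₂ t₁ t₂ t} : Run c r s r₁ s₁ t₁ → Run d r₁ s₁ r₂ s₂ t₂ →
      t₁ + t₂ ≤ t → Run (.seq c d) r s r₂ s₂ t
  | ite_true {p c d r s r' s' t₁ t} : p r = true → Run c r s r' s' t₁ → t₁ + 1 ≤ t →
      Run (.ite p c d) r s r' s' t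
  | ite_false {p c d r s r' s' t₁ t} : p r = false → Run d r s r' s' t₁ → t₁ + 1 ≤ t →
      Run (.ite p c d) r s r' s' t
  | loop_exit {k p c r s t} : p (s k).head? = false → 1 ≤ t →
      Run (.loop k p c) r s (s k).head? (Function.update s k (s k).tail) t
  | loop_step {k p c r s r₁ s₁ r₂ s₂ t₁ t₂ t} : p (s k).head? = true →
      Run c (s k).head? (Function.update s k (s k).tail) r₁ s₁ t₁ →
      Run (.loop k p c) r₁ s₁ r₂ s₂ t₂ → t₁ + t₂ + 1 ≤ t →
      Run (.loop k p c) r s r₂ s₂ t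

theorem Run.mono {c : Cmd K} {r s r' s' t t'} (h : Run c r s r' s' t) (ht : t ≤ t') :
    Run c r s r' s' t' := by
  cases h with
  | put h => exact .put (h.trans ht)
  | copy h => exact .copy (h.trans ht)
  | pop h => exact .pop (h.trans ht)
  | seq h₁ h₂ h => exact .seq h₁ h₂ (h.trans ht)
  | ite_true hp h₁ h => exact .ite_true hp h₁ (h.trans ht)
  | ite_false hp h₁ h => exact .ite_false hp h₁ (h.trans ht)
  | loop_exit hp h => exact .loop_exit hp (h.trans ht)
  | loop_step hp h₁ h₂ h => exact .loop_step hp h₁ h₂ (h.trans ht)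

theorem Run.congr {c : Cmd K} {r s r₁ s₁ t s' r₁' s₁' t'} (h : Run c r s r₁ s₁ t) (hs : s = s')
    (hr : r₁ = r₁') (hs₁ : s₁ = s₁') (ht : t ≤ t') : Run c r s' r₁' s₁' t' := by
  subst hs hr hs₁
  exact h.mono ht

/-! ### Compilation to Turing machines -/

/-- The program points of a program: the labels of the machine that runs it. -/
def Cmd.Label : Cmd K → Type
  | .put _ _ => Unit
  | .copy _ => Unit
  | .pop _ => Unit
  | .seq c d => c.Label ⊕ d.Label
  | .ite _ c d => Option (c.Label ⊕ d.Label)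
  | .loop _ _ c => Option c.Label

/-- There are finitely many program points. -/
@[reducible]
def Cmd.labelFintype : (c : Cmd K) → Fintype c.Label
  | .put _ _ => inferInstanceAs (Fintype Unit)
  | .copy _ => inferInstanceAs (Fintype Unit)
  | .pop _ => inferInstanceAs (Fintype Unit)
  | .seq c d =>
    haveI := c.labelFintype
    haveI := d.labelFintype
    inferInstanceAs (Fintype (c.Label ⊕ d.Label))
  | .ite _ c d =>
    haveI := c.labelFintype
    haveI := d.labelFintype
    inferInstanceAs (Fintype (Option (c.Label ⊕ d.Label)))
  | .loop _ _ c =>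
    haveI := c.labelFintype
    inferInstanceAs (Fintype (Option c.Label))

/-- The program point at which a program starts. -/
def Cmd.entry : (c : Cmd K) → c.Label
  | .put _ _ => ()
  | .copy _ => ()
  | .pop _ => ()
  | .seq c _ => Sum.inl c.entry
  | .ite _ _ _ => none
  | .loop _ _ _ => none

/-- The statement at each program point, where `emb` embeds the program points into the labels of
the whole machine, and `exit` is the label at which to continue after the program. -/
def Cmd.code {Λ : Type} : (c : Cmd K) → (c.Label → Λ) → Λ → c.Label →
    Turing.TM2.Stmt (fun _ : K => Γ') Λ (Option Γ')
  | .put k l, _, exit, _ => l.foldr (fun a q => .push k (fun _ => a) q) (.goto fun _ => exit)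
  | .copy k, _, exit, _ => .push k (fun r => r.getD Γ'.blank) (.goto fun _ => exit)
  | .pop k, _, exit, _ => .pop k (fun _ a => a) (.goto fun _ => exit)
  | .seq c d, emb, exit, l =>
    match l with
    | Sum.inl l => c.code (fun l => emb (Sum.inl l)) (emb (Sum.inr d.entry)) l
    | Sum.inr l => d.code (fun l => emb (Sum.inr l)) exit l
  | .ite p c d, emb, exit, l =>
    match l with
    | none => .branch p (.goto fun _ => emb (some (Sum.inl c.entry)))
        (.goto fun _ => emb (some (Sum.inr d.entry)))
    | some (Sum.inl l) => c.code (fun l => emb (some (Sum.inl l))) exit l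
    | some (Sum.inr l) => d.code (fun l => emb (some (Sum.inr l))) exit l
  | .loop k p c, emb, exit, l =>
    match l with
    | none => .pop k (fun _ a => a) (.branch p (.goto fun _ => emb (some c.entry))
        (.goto fun _ => exit))
    | some l => c.code (fun l => emb (some l)) (emb none) l

/-- `n` steps of the machine `M` lead from one configuration to another, for some `n ≤ t`. -/
def StepsTo {Λ : Type} (M : Λ → Turing.TM2.Stmt (fun _ : K => Γ') Λ (Option Γ'))
    (a b : Turing.TM2.Cfg (fun _ : K => Γ') Λ (Option Γ')) (t : ℕ) : Prop :=
  ∃ n ≤ t, (flip bind (Turing.TM2.step M))^[n] (some a) = some b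

theorem StepsTo.trans {Λ : Type} {M : Λ → Turing.TM2.Stmt (fun _ : K => Γ') Λ (Option Γ')}
    {a b c t₁ t₂ t} (h₁ : StepsTo M a b t₁) (h₂ : StepsTo M b c t₂) (h : t₁ + t₂ ≤ t) :
    StepsTo M a c t := by
  obtain ⟨n₁, hn₁, e₁⟩ := h₁
  obtain ⟨n₂, hn₂, e₂⟩ := h₂
  exact ⟨n₂ + n₁, by omega, by rw [Function.iterate_add_apply, e₁, e₂]⟩

theorem StepsTo.single {Λ : Type} {M : Λ → Turing.TM2.Stmt (fun _ : K => Γ') Λ (Option Γ')}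
    {a b t} (h : Turing.TM2.step M a = some b) (ht : 1 ≤ t) : StepsTo M a b t :=
  ⟨1, ht, h⟩

theorem stepAux_foldr_push {Λ : Type} (k : K) (q : Turing.TM2.Stmt (fun _ : K => Γ') Λ (Option Γ'))
    (l : List Γ') (r : Option Γ') (s : K → List Γ') :
    Turing.TM2.stepAux (l.foldr (fun a q => .push k (fun _ => a) q) q) r s =
      Turing.TM2.stepAux q r (Function.update s k (l.reverse ++ s k)) := by
  induction l generalizing s with
  | nil => simp
  | cons a l ih => simp [ih]

/-- A machine that contains the code of a program runs that program. -/
theorem Run.stepsTo {Λ : Type} {M : Λ → Turing.TM2.Stmt (fun _ : K => Γ') Λ (Option Γ')}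
    {c : Cmd K} {r s r' s' t} (h : Run c r s r' s' t) :
    ∀ (emb : c.Label → Λ) (exit : Λ), (∀ l, M (emb l) = c.code emb exit l) →
      StepsTo M ⟨some (emb c.entry), r, s⟩ ⟨some exit, r', s'⟩ t := by
  induction h with
  | put h | copy h | pop h =>
    intro emb exit hM
    refine .single ?_ h
    simp [Turing.TM2.step, hM, Cmd.code, stepAux_foldr_push]
  | @seq c d r s r₁ s₁ r₂ s₂ t₁ t₂ t _ _ h ih₁ ih₂ =>
    intro emb exit hM
    exact (ih₁ (fun l => emb (Sum.inl l)) (emb (Sum.inr d.entry))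
      (fun l => hM (Sum.inl l))).trans
      (ih₂ (fun l => emb (Sum.inr l)) exit (fun l => hM (Sum.inr l))) h
  | @ite_true p c d r s r' s' t₁ t hp _ h ih =>
    intro emb exit hM
    refine StepsTo.trans (t₁ := 1) (.single ?_ le_rfl)
      (ih (fun l => emb (some (Sum.inl l))) exit (fun l => hM (some (Sum.inl l)))) (by omega)
    have := hM none
    simp [Turing.TM2.step, Cmd.entry, this, Cmd.code, hp]
  | @ite_false p c d r s r' s' t₁ t hp _ h ih =>
    intro emb exit hM
    refine StepsTo.trans (t₁ := 1) (.single ?_ le_rfl)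
      (ih (fun l => emb (some (Sum.inr l))) exit (fun l => hM (some (Sum.inr l)))) (by omega)
    have := hM none
    simp [Turing.TM2.step, Cmd.entry, this, Cmd.code, hp]
  | @loop_exit k p c r s t hp h =>
    intro emb exit hM
    refine .single ?_ h
    have := hM none
    simp [Turing.TM2.step, Cmd.entry, this, Cmd.code, hp]
  | @loop_step k p c r s r₁ s₁ r₂ s₂ t₁ t₂ t hp _ _ h ih₁ ih₂ =>
    intro emb exit hM
    refine StepsTo.trans (t₁ := 1) (.single ?_ le_rfl)
      ((ih₁ (fun l => emb (some l)) (emb none) (fun l => hM (some l))).trans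
        (ih₂ emb exit hM) le_rfl) (by omega)
    have := hM none
    simp [Turing.TM2.step, Cmd.entry, this, Cmd.code, hp]

/-- The Turing machine that runs a program, with given input and output stacks, and halts. -/
def Cmd.machine [Fintype K] (c : Cmd K) (k₀ k₁ : K) : Turing.FinTM2 :=
  haveI := c.labelFintype
  { K := K
    k₀ := k₀
    k₁ := k₁
    Γ := fun _ => Γ'
    Λ := Option c.Label
    main := some c.entry
    σ := Option Γ'
    initialState := none
    Γk₀Fin := inferInstanceAs (Fintype Γ')
    m := fun l =>
      match l with
      | none => .halt
      | some l => c.code some none l }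

/-- A function is computable in polynomial time if a program computes it, with polynomially many
steps, from the input on one stack to the output on another, and leaves everything else empty. -/
theorem polyTime_of_run [Fintype K] {α β : Type} {ea : α → List Γ'} {eb : β → List Γ'} {f : α → β}
    (c : Cmd K) (k₀ k₁ : K) (time : Polynomial ℕ)
    (h : ∀ a, Run c none (Function.update (fun _ => []) k₀ (ea a)) none
      (Function.update (fun _ => []) k₁ (eb (f a))) (time.eval (ea a).length)) :
    Nonempty (Turing.TM2ComputableInPolyTime ea eb f) := by
  refine ⟨⟨⟨c.machine k₀ k₁, Equiv.refl Γ', Equiv.refl Γ'⟩, time + 1, fun a => ?_⟩⟩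
  have h1 : StepsTo (c.machine k₀ k₁).m (Turing.initList (c.machine k₀ k₁) (ea a))
      (Turing.haltList (c.machine k₀ k₁) (eb (f a))) ((time + 1).eval (ea a).length) := by
    have h2 := (h a).stepsTo (M := (c.machine k₀ k₁).m) some none (fun _ => rfl)
    have h3 := h2.trans (t₂ := 1) (t := (time + 1).eval (ea a).length)
      (.single (b := ⟨none, none, _⟩) rfl le_rfl) (by simp)
    have hinit : Turing.initList (c.machine k₀ k₁) (ea a) =
        ⟨some (some c.entry), none, Function.update (fun _ => []) k₀ (ea a)⟩ := by
      refine congrArg (Turing.TM2.Cfg.mk (some (some c.entry)) none) (funext fun k : K => ?_)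
      by_cases hk : k = k₀
      · cases hk
        exact (dif_pos rfl).trans (Function.update_self (f := fun _ : K => []) ..).symm
      · exact (dif_neg hk).trans (Function.update_of_ne (f := fun _ : K => []) hk _).symm
    have hhalt : Turing.haltList (c.machine k₀ k₁) (eb (f a)) =
        ⟨none, none, Function.update (fun _ => []) k₁ (eb (f a))⟩ := by
      refine congrArg (Turing.TM2.Cfg.mk none none) (funext fun k : K => ?_)
      by_cases hk : k = k₁
      · cases hk
        exact (dif_pos rfl).trans (Function.update_self (f := fun _ : K => []) ..).symm
      · exact (dif_neg hk).trans (Function.update_of_ne (f := fun _ : K => []) hk _).symm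
    rw [hinit, hhalt]
    exact h3
  choose n hn e using h1
  have e' : ∀ x y : List Γ', x = ea a → y = eb (f a) →
      (flip bind (Turing.TM2.step (c.machine k₀ k₁).m))^[n]
        (some (Turing.initList (c.machine k₀ k₁) x)) =
      some (Turing.haltList (c.machine k₀ k₁) y) := by
    rintro _ _ rfl rfl
    exact e
  exact ⟨⟨n, e' _ _ (List.map_id _) (List.map_id _)⟩, hn⟩

end Language

/-! ### Transducers -/

/-- The stacks of the reduction. The output word is collected on `w` in reverse order; `len` and
`thr` hold multiples of the length of the input in unary; `row` and `col` hold the number of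
vertices in unary, and `rowd` and `done` the parts of them that an enclosing loop has passed; `sgn`,
`num` and `den` hold the current weight. -/
inductive Stack
  | inp | out | w | row | rowd | col | done | len | thr | sgn | num | den | aux | aux2
  deriving DecidableEq

instance : Fintype Stack :=
  Fintype.ofList [.inp, .out, .w, .row, .rowd, .col, .done, .len, .thr, .sgn, .num, .den, .aux,
    .aux2] (by intro k; cases k <;> simp)

/-- The contents of all stacks. -/
abbrev Ctx : Type := Stack → List Γ'

/-- The contents `s`, but with `u` on the input stack and `v` on the stack `w`. -/
def io (s : Ctx) (u v : List Γ') : Ctx :=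
  Function.update (Function.update s .inp u) .w v

@[simp] theorem io_inp (s : Ctx) (u v) : io s u v .inp = u := by simp [io]

@[simp] theorem io_w (s : Ctx) (u v) : io s u v .w = v := by simp [io]

/-- A stack other than those for input and output. -/
abbrev Inner (k : Stack) : Prop := k ≠ .inp ∧ k ≠ .w

theorem io_inner {k : Stack} (hk : Inner k) (s : Ctx) (u v) : io s u v k = s k := by
  simp [io, hk.1, hk.2]

theorem update_io {k : Stack} (hk : Inner k) (s : Ctx) (u v l) :
    Function.update (io s u v) k l = io (Function.update s k l) u v := by
  rw [io, io, Function.update_comm hk.2.symm, Function.update_comm hk.1.symm]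

@[simp] theorem update_io_inp (s : Ctx) (u v l) :
    Function.update (io s u v) .inp l = io s l v := by
  rw [io, io, Function.update_comm (by decide), Function.update_idem]

@[simp] theorem update_io_w (s : Ctx) (u v l) :
    Function.update (io s u v) .w l = io s u l := by
  rw [io, io, Function.update_idem]

/-- Started with register `r`, the program `c` reads the word `I` from the input, appends the
word `E` to the output, and changes the contents of the other stacks from `s` to `s'`, all in
at most `t` steps. -/
def Trans (c : Cmd Stack) (r : Option Γ') (s : Ctx) (I E : List Γ') (s' : Ctx) (t : ℕ) : Prop :=
  ∀ u v, ∃ r', Run c r (io s (I ++ u) v) r' (io s' u (E.reverse ++ v)) t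

theorem Trans.mono {c r s I E s' t t'} (h : Trans c r s I E s' t) (ht : t ≤ t') :
    Trans c r s I E s' t' := fun u v => (h u v).imp fun _ h => h.mono ht

theorem Trans.seq {c d r s s₁ s₂ I₁ I₂ E₁ E₂ t₁ t₂} (h₁ : Trans c r s I₁ E₁ s₁ t₁)
    (h₂ : ∀ r, Trans d r s₁ I₂ E₂ s₂ t₂) :
    Trans (c ;; d) r s (I₁ ++ I₂) (E₁ ++ E₂) s₂ (t₁ + t₂) := by
  intro u v
  obtain ⟨r₁, h₁⟩ := h₁ (I₂ ++ u) v
  obtain ⟨r₂, h₂⟩ := h₂ r₁ u (E₁.reverse ++ v)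
  refine ⟨r₂, .seq (t₁ := t₁) (t₂ := t₂) (r₁ := r₁) (s₁ := io s₁ (I₂ ++ u) (E₁.reverse ++ v))
    ?_ ?_ le_rfl⟩
  · simpa using h₁
  · simpa using h₂

theorem trans_put_w (l r s) : Trans (.put .w l) r s [] l s 1 := fun u v =>
  ⟨r, by simpa using Run.put (k := .w) (l := l) (r := r) (s := io s u v) (le_refl 1)⟩

theorem trans_put {k : Stack} (hk : Inner k) (l r s) :
    Trans (.put k l) r s [] [] (Function.update s k (l.reverse ++ s k)) 1 := by
  intro u v
  have h := Run.put (k := k) (l := l) (r := r) (s := io s u v) (le_refl 1)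
  exact ⟨r, by simpa [update_io hk, io_inner hk] using h⟩

theorem trans_copy_w (x s) : Trans (.copy .w) (some x) s [] [x] s 1 := fun u v =>
  ⟨some x, by simpa using Run.copy (k := .w) (r := some x) (s := io s u v) (le_refl 1)⟩

theorem trans_copy {k : Stack} (hk : Inner k) (x s) :
    Trans (.copy k) (some x) s [] [] (Function.update s k (x :: s k)) 1 := by
  intro u v
  have h := Run.copy (k := k) (r := some x) (s := io s u v) (le_refl 1)
  exact ⟨some x, by simpa [update_io hk, io_inner hk] using h⟩

/-- Copying keeps the register, so what follows may use it. -/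
theorem trans_copy_seq {k : Stack} (hk : Inner k) {c x s I E s' t}
    (h : Trans c (some x) (Function.update s k (x :: s k)) I E s' t) :
    Trans (.copy k ;; c) (some x) s I E s' (t + 1) := fun u v => by
  obtain ⟨r', h⟩ := h u v
  have h1 := Run.copy (k := k) (r := some x) (s := io s (I ++ u) v) (le_refl 1)
  rw [update_io hk, io_inner hk] at h1
  exact ⟨r', .seq h1 h (by omega)⟩

/-- Branching on the top symbol of a stack, which is popped. -/
theorem trans_pop_ite {k : Stack} (hk : Inner k) {p c d r s I E s' t}
    (h : Trans (bif p (s k).head? then c else d) (s k).head? (Function.update s k (s k).tail)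
      I E s' t) :
    Trans (.pop k ;; .ite p c d) r s I E s' (t + 2) := fun u v => by
  obtain ⟨r', h⟩ := h u v
  have h1 := Run.pop (k := k) (r := r) (s := io s (I ++ u) v) (le_refl 1)
  rw [update_io hk, io_inner hk] at h1
  refine ⟨r', .seq h1 (t₂ := t + 1) ?_ (by omega)⟩
  cases hp : p (s k).head? with
  | true => rw [hp] at h; exact .ite_true hp h le_rfl
  | false => rw [hp] at h; exact .ite_false hp h le_rfl

/-- Branching on the next symbol of the input. -/
theorem trans_read_ite {p c d r s x I E s' t}
    (h : Trans (bif p (some x) then c else d) (some x) s I E s' t) :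
    Trans (.pop .inp ;; .ite p c d) r s (x :: I) E s' (t + 2) := fun u v => by
  obtain ⟨r', h⟩ := h u v
  have h1 := Run.pop (k := .inp) (r := r) (s := io s (x :: I ++ u) v) (le_refl 1)
  rw [update_io_inp, io_inp] at h1
  refine ⟨r', .seq h1 (t₂ := t + 1) ?_ (by omega)⟩
  cases hp : p (some x) with
  | true => rw [hp] at h; exact .ite_true hp h le_rfl
  | false => rw [hp] at h; exact .ite_false hp h le_rfl

/-- Run the body once for each symbol of a stack, which is emptied. -/
abbrev Cmd.each (k : Stack) (c : Cmd Stack) : Cmd Stack := .loop k Option.isSome c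

/-- The contexts `C i` describe all stacks but `k` after `i` rounds of the loop. -/
theorem trans_each {k : Stack} (hk : Inner k) {c t} (xs : List Γ') (C : ℕ → Ctx)
    (I E : ℕ → List Γ')
    (h : ∀ i (hi : i < xs.length), Trans c (some xs[i])
      (Function.update (C i) k (xs.drop (i + 1))) (I i) (E i)
      (Function.update (C (i + 1)) k (xs.drop (i + 1))) t) (r) :
    Trans (.each k c) r (Function.update (C 0) k xs) ((List.range xs.length).flatMap I)
      ((List.range xs.length).flatMap E) (Function.update (C xs.length) k [])
      (xs.length * (t + 1) + 1) := by
  induction xs generalizing C I E r with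
  | nil =>
    intro u v
    have h1 := Run.loop_exit (k := k) (p := Option.isSome) (c := c) (r := r)
      (s := io (Function.update (C 0) k []) u v) (by simp [io_inner hk]) (le_refl 1)
    rw [update_io hk, io_inner hk] at h1
    exact ⟨_, by simpa using h1⟩
  | cons x xs ih =>
    intro u v
    obtain ⟨r₁, h0⟩ := h 0 (by simp) ((List.range xs.length).flatMap (fun i => I (i + 1)) ++ u) v
    obtain ⟨r₂, h1⟩ := ih (fun i => C (i + 1)) (fun i => I (i + 1)) (fun i => E (i + 1))
      (fun i hi => h (i + 1) (by simpa using hi)) r₁ u ((E 0).reverse ++ v)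
    refine ⟨r₂, ?_⟩
    simp only [List.length_cons, List.range_succ_eq_map, List.flatMap_cons, List.flatMap_map,
      List.append_assoc, List.reverse_append]
    refine Run.loop_step (t₁ := t) (t₂ := xs.length * (t + 1) + 1) (r₁ := r₁) ?_ ?_ h1 (by lia)
    · simp [io_inner hk]
    · simpa [io_inner hk, update_io hk] using h0

theorem Trans.congr {c r s s' I I' E E' s₁ s₁' t} (h : Trans c r s I E s₁ t) (hs : s = s')
    (hI : I = I') (hE : E = E') (hs₁ : s₁ = s₁') : Trans c r s' I' E' s₁' t := by
  subst hs hI hE hs₁; exact h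

theorem run_move {k k' : Stack} (hne : k ≠ k') (r s) :
    Run (.each k (.copy k')) r s none
      (Function.update (Function.update s k []) k' ((s k).reverse ++ s k'))
      ((s k).length * 2 + 1) := by
  generalize hl : s k = l
  induction l generalizing r s with
  | nil =>
    have h := Run.loop_exit (k := k) (p := Option.isSome) (c := .copy k') (r := r) (s := s)
      (by simp [hl]) (le_refl 1)
    rw [hl] at h
    refine h.congr rfl rfl ?_ le_rfl
    funext j
    grind [Function.update_apply]
  | cons x l ih =>
    have h1 := Run.copy (k := k') (r := some x) (s := Function.update s k l) (le_refl 1)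
    have h2 := ih (some x) (Function.update (Function.update s k l) k' (x :: s k'))
      (by simp [hne])
    refine Run.loop_step (p := Option.isSome) (t₁ := 1) (r₁ := some x)
      (s₁ := Function.update (Function.update s k l) k' (x :: s k'))
      (by simp [hl]) ?_ (h2.congr rfl rfl ?_ le_rfl) (t₂ := l.length * 2 + 1)
      (by simp only [List.length_cons]; lia)
    · simpa [hl, hne.symm] using h1
    · funext j
      grind [Function.update_apply]

theorem trans_move {k k' : Stack} (hk : Inner k) (hk' : Inner k') (hne : k ≠ k') (r s) :
    Trans (.each k (.copy k')) r s [] []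
      (Function.update (Function.update s k []) k' ((s k).reverse ++ s k'))
      ((s k).length * 2 + 1) := by
  intro u v
  have h := run_move hne r (io s u v)
  rw [update_io hk, update_io hk', io_inner hk, io_inner hk'] at h
  exact ⟨_, h⟩

theorem trans_clear {k : Stack} (hk : Inner k) (r s) :
    Trans (.each k (.put .w [])) r s [] [] (Function.update s k []) ((s k).length * 2 + 1) := by
  have h := trans_each hk (c := .put .w []) (t := 1) (s k) (fun _ => s) (fun _ => []) (fun _ => [])
    (fun i hi => trans_put_w _ _ _) r
  exact h.congr (by simp) (by simp) (by simp) rfl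

/-- Run the body once for each symbol of the stack `k`, collecting the symbols on the stack `k'`,
and restore the stack in the end. -/
def Cmd.scan (k k' : Stack) (c : Cmd Stack) : Cmd Stack :=
  .each k (.copy k' ;; c) ;; .each k' (.copy k)

/-- The contexts `C i` describe all stacks but `k` and `k'` after `i` rounds of the loop. During
round `i` the stack `k'` holds the `i + 1` symbols that have been taken from `k`. -/
theorem trans_scan {k k' : Stack} (hk : Inner k) (hk' : Inner k') (hne : k ≠ k') {c t}
    (xs : List Γ') (C : ℕ → Ctx) (I E : ℕ → List Γ')
    (h : ∀ i (hi : i < xs.length), Trans c (some xs[i])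
      (Function.update (Function.update (C i) k (xs.drop (i + 1))) k' (xs.take (i + 1)).reverse)
      (I i) (E i)
      (Function.update (Function.update (C (i + 1)) k (xs.drop (i + 1))) k'
        (xs.take (i + 1)).reverse) t) (r) :
    Trans (.scan k k' c) r (Function.update (Function.update (C 0) k xs) k' [])
      ((List.range xs.length).flatMap I) ((List.range xs.length).flatMap E)
      (Function.update (Function.update (C xs.length) k xs) k' [])
      (xs.length * (t + 4) + 2) := by
  have h1 := trans_each hk (c := .copy k' ;; c) (t := t + 1) xs
    (fun i => Function.update (C i) k' (xs.take i).reverse) I E (fun i hi => ?_) r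
  · have h2 := fun r => trans_move hk' hk hne.symm r
      (Function.update (Function.update (C xs.length) k' (xs.take xs.length).reverse) k [])
    refine ((Trans.seq h1 h2).congr ?_ (by simp) (by simp) ?_).mono ?_
    · funext j
      grind [Function.update_apply]
    · funext j
      grind [Function.update_apply]
    · grind [Function.update_apply]
  · refine trans_copy_seq hk' ((h i hi).congr ?_ rfl rfl ?_)
    · rw [List.take_succ_eq_append_getElem hi]
      funext j
      grind [Function.update_apply]
    · funext j
      grind [Function.update_apply]

/-- A scan whose body changes neither of the stacks. -/
theorem trans_scan_const {k k' : Stack} (hk : Inner k) (hk' : Inner k') (hne : k ≠ k') {c t s}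
    (hs' : s k' = []) (I E : ℕ → List Γ')
    (h : ∀ i (hi : i < (s k).length), Trans c (some (s k)[i])
      (Function.update (Function.update s k ((s k).drop (i + 1))) k'
        ((s k).take (i + 1)).reverse) (I i) (E i)
      (Function.update (Function.update s k ((s k).drop (i + 1))) k'
        ((s k).take (i + 1)).reverse) t) (r) :
    Trans (.scan k k' c) r s ((List.range (s k).length).flatMap I)
      ((List.range (s k).length).flatMap E) s ((s k).length * (t + 4) + 2) := by
  have h1 := trans_scan hk hk' hne (s k) (fun _ => s) I E h r
  have h2 : Function.update (Function.update s k (s k)) k' [] = s := by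
    rw [Function.update_eq_self, ← hs', Function.update_eq_self]
  rwa [h2] at h1

/-- Append the content of a stack to the output. -/
def Cmd.emit (k k' : Stack) : Cmd Stack := .scan k k' (.copy .w)

theorem trans_emit {k k' : Stack} (hk : Inner k) (hk' : Inner k') (hne : k ≠ k') {s}
    (hs' : s k' = []) (r) : Trans (.emit k k') r s [] (s k) s ((s k).length * 5 + 2) := by
  have h := trans_scan_const hk hk' hne hs' (c := .copy .w) (t := 1) (fun _ => [])
    (fun i => ((s k)[i]?).toList) (fun i hi => ?_) r
  · have e : ∀ l : List Γ', (List.range l.length).flatMap (fun i => (l[i]?).toList) = l := by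
      intro l
      induction l with
      | nil => rfl
      | cons x l ih =>
        rw [List.length_cons, List.range_succ_eq_map, List.flatMap_cons, List.flatMap_map]
        simpa using ih
    exact h.congr rfl (by simp) (e _) rfl
  · simpa [hi] using trans_copy_w (s k)[i] _

/-- Append a fixed word to the output once for each symbol of a stack. -/
def Cmd.fill (k k' : Stack) (l : List Γ') : Cmd Stack := .scan k k' (.put .w l)

theorem trans_fill {k k' : Stack} (hk : Inner k) (hk' : Inner k') (hne : k ≠ k') {s}
    (hs' : s k' = []) (l r) :
    Trans (.fill k k' l) r s [] ((List.replicate (s k).length l).flatten) s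
      ((s k).length * 5 + 2) := by
  have h := trans_scan_const hk hk' hne hs' (c := .put .w l) (t := 1) (fun _ => [])
    (fun _ => l) (fun i hi => trans_put_w l _ _) r
  have e : (List.range (s k).length).flatMap (fun _ => l) =
      (List.replicate (s k).length l).flatten := by
    rw [List.flatMap, List.map_const', List.length_range]
  exact h.congr rfl (by simp) e rfl

/-! ### Binary numbers -/

/-- The binary digits of a number, least significant first, as symbols. -/
def bitWord (n : ℕ) : List Γ' := n.bits.map Γ'.bit

theorem encNat_eq (n : ℕ) : encNat n = bitWord n ++ [Γ'.comma] := rfl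

theorem length_bitWord (n : ℕ) : (bitWord n).length = n.size := by
  rw [bitWord, List.length_map, Nat.size_eq_bits_len]

theorem bits_two_mul_add {n : ℕ} (b : Bool) (h : 0 < n ∨ b = true) :
    (2 * n + b.toNat).bits = b :: n.bits := by
  rw [← Nat.bits_append_bit n b (by rintro rfl; simpa using h), Nat.bit_val]

/-- Concatenation of binary expansions: the lower number is padded to `m` digits. -/
theorem bits_pow_mul_add (m : ℕ) {b : ℕ} (hb : 0 < b) (a : ℕ) (ha : a.size ≤ m) :
    (2 ^ m * b + a).bits = a.bits ++ List.replicate (m - a.size) false ++ b.bits := by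
  induction m generalizing a with
  | zero =>
    have : a = 0 := Nat.size_eq_zero.1 (by omega)
    simp [this]
  | succ m ih =>
    have hpos : 0 < 2 ^ m * b := by positivity
    -- One more digit: split off the lowest digit `c` of `a`.
    have key : ∀ (c : Bool) (a' : ℕ), a = 2 * a' + c.toNat → a'.size ≤ m →
        (2 ^ (m + 1) * b + a).bits =
          c :: (a'.bits ++ List.replicate (m - a'.size) false ++ b.bits) := by
      intro c a' h h'
      rw [← ih a' h', ← bits_two_mul_add c (Or.inl (by omega)), h]
      congr 1
      ring
    rcases Nat.eq_zero_or_pos a with rfl | hpa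
    · rw [key false 0 (by simp) (by simp)]
      simp [List.replicate_succ]
    · have h2 : a = 2 * (a / 2) + (decide (a % 2 = 1)).toNat := by
        rcases Nat.mod_two_eq_zero_or_one a with h | h <;> simp [h] <;> omega
      have hor : 0 < a / 2 ∨ decide (a % 2 = 1) = true := by simp; omega
      have hbits := bits_two_mul_add _ hor
      rw [← h2] at hbits
      have hs : a.size = (a / 2).size + 1 := by
        rw [← Nat.size_eq_bits_len, ← Nat.size_eq_bits_len, hbits]; simp
      rw [key _ (a / 2) h2 (by omega), hbits, hs]
      simp

theorem bitWord_pow_mul_add (m : ℕ) {b : ℕ} (hb : 0 < b) (a : ℕ) (ha : a.size ≤ m) :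
    bitWord (2 ^ m * b + a) =
      (bitWord a ++ List.replicate (m - a.size) (Γ'.bit false)) ++ bitWord b := by
  simp [bitWord, bits_pow_mul_add m hb a ha]

theorem bitWord_pow_mul (m : ℕ) {b : ℕ} (hb : 0 < b) :
    bitWord (2 ^ m * b) = List.replicate m (Γ'.bit false) ++ bitWord b := by
  simpa [bitWord] using bitWord_pow_mul_add m hb 0 (by simp)

theorem bitWord_one : bitWord 1 = [Γ'.bit true] := by simp [bitWord]

theorem bitWord_two_pow_sub_one (k : ℕ) :
    bitWord (2 ^ k - 1) = List.replicate k (Γ'.bit true) := by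
  induction k with
  | zero => simp [bitWord]
  | succ k ih =>
    have h : 2 ^ (k + 1) - 1 = 2 * (2 ^ k - 1) + true.toNat := by
      have := Nat.one_le_two_pow (n := k)
      simp only [pow_succ, Bool.toNat_true]; omega
    rw [h, bitWord, bits_two_mul_add _ (Or.inr rfl), List.map_cons, ← bitWord, ih,
      List.replicate_succ]

/-- The successor on binary expansions. -/
def incBits : List Bool → List Bool
  | [] => [true]
  | false :: l => true :: l
  | true :: l => false :: incBits l

theorem bits_succ (n : ℕ) : (n + 1).bits = incBits n.bits := by
  induction n using Nat.strongRecOn with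
  | _ n ih =>
    rcases Nat.eq_zero_or_pos n with rfl | hn
    · simp [incBits]
    · rcases Nat.even_or_odd' n with ⟨k, rfl | rfl⟩
      · have h1 := bits_two_mul_add (n := k) false (Or.inl (by omega))
        have h2 := bits_two_mul_add (n := k) true (Or.inr rfl)
        simp only [Bool.toNat_false, add_zero, Bool.toNat_true] at h1 h2
        rw [h1, h2, incBits]
      · have h1 := bits_two_mul_add (n := k + 1) false (Or.inl (by omega))
        have h2 := bits_two_mul_add (n := k) true (Or.inr rfl)
        simp only [Bool.toNat_false, add_zero, Bool.toNat_true] at h1 h2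
        rw [h2, incBits, ← ih k (by omega), ← h1]
        congr 1

/-! ### Subprograms for numbers -/

/-- The register holds a bit. -/
def isBit : Option Γ' → Bool
  | some (Γ'.bit _) => true
  | _ => false

/-- Read a binary number. -/
def Cmd.readNat (k : Stack) : Cmd Stack := .loop .inp isBit (.copy .aux) ;; .each .aux (.copy k)

/-- Reading bits up to and including a marker. -/
theorem trans_loop_isBit {c : Cmd Stack} (x : Γ') (hx : isBit (some x) = false) (l : List Bool)
    (C : ℕ → Ctx) (t : ℕ)
    (h : ∀ i (hi : i < l.length), Trans c (some (Γ'.bit l[i])) (C i) [] [] (C (i + 1)) t) (r) :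
    Trans (.loop .inp isBit c) r (C 0) (l.map Γ'.bit ++ [x]) [] (C l.length)
      (l.length * (t + 1) + 1) := by
  induction l generalizing C r with
  | nil =>
    intro u v
    have h1 := Run.loop_exit (k := .inp) (p := isBit) (c := c) (r := r)
      (s := io (C 0) ([x] ++ u) v) (by simpa using hx) (le_refl 1)
    rw [update_io_inp] at h1
    exact ⟨_, by simpa using h1⟩
  | cons b l ih =>
    intro u v
    obtain ⟨r₁, h0⟩ := h 0 (by simp) (l.map Γ'.bit ++ [x] ++ u) v
    obtain ⟨r₂, h1⟩ := ih (fun i => C (i + 1))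
      (fun i hi => h (i + 1) (by simpa using hi)) r₁ u v
    refine ⟨r₂, Run.loop_step (t₁ := t) (t₂ := l.length * (t + 1) + 1) (r₁ := r₁)
      (s₁ := io (C 1) (l.map Γ'.bit ++ [x] ++ u) v) ?_ ?_ ?_ ?_⟩
    · simp [isBit]
    · simpa using h0
    · simpa using h1
    · simp only [List.length_cons]; lia

theorem trans_readNat {k : Stack} (hk : Inner k) (hne : k ≠ .aux) {s : Ctx} (hs : s .aux = [])
    (n : ℕ) (r) :
    Trans (.readNat k) r s (encNat n) [] (Function.update s k (bitWord n ++ s k))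
      (4 * n.size + 2) := by
  have ha : Inner Stack.aux := by decide
  have h1 := trans_loop_isBit (c := .copy .aux) Γ'.comma rfl n.bits
    (fun i => Function.update s .aux (((bitWord n).take i).reverse)) 1 (fun i hi => ?_) r
  · refine (Trans.seq h1 (fun r => trans_move ha hk hne.symm r _)).congr ?_ ?_ ?_ ?_ |>.mono ?_
    · funext j
      grind [Function.update_apply]
    · simp [encNat]
    · simp
    · have : (bitWord n).take n.bits.length = bitWord n :=
        List.take_of_length_le (by simp [bitWord])
      funext j
      grind [Function.update_apply]
    · have := length_bitWord n
      rw [Nat.size_eq_bits_len] at *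
      simp [this]; lia
  · refine (trans_copy ha _ _).congr rfl rfl rfl ?_
    have : i < (bitWord n).length := by simpa [bitWord] using hi
    rw [List.take_succ_eq_append_getElem this]
    funext j
    by_cases hj : j = .aux <;> simp [hj, Function.update_apply, bitWord]

/-- Pad the content of the stack `num` with zeros to the length of the stack `len`. -/
def Cmd.pad : Cmd Stack :=
  .scan .len .aux2 (.pop .num ;; .ite Option.isSome (.copy .aux) (.put .aux [Γ'.bit false])) ;;
    .each .aux (.copy .num)

theorem trans_pad {s : Ctx} (hs : s .aux = []) (hs2 : s .aux2 = [])
    (hl : (s .num).length ≤ (s .len).length) (r) :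
    Trans .pad r s [] [] (Function.update s .num (s .num ++
      List.replicate ((s .len).length - (s .num).length) (Γ'.bit false)))
      (9 * (s .len).length + 3) := by
  set A := s .num with hA
  set P := A ++ List.replicate ((s .len).length - A.length) (Γ'.bit false) with hP
  have hPl : P.length = (s .len).length := by simp [hP]; omega
  have h1 := trans_scan (k := .len) (k' := .aux2) (by decide) (by decide) (by decide)
    (c := .pop .num ;; .ite Option.isSome (.copy .aux) (.put .aux [Γ'.bit false])) (t := 3)
    (s .len) (fun i => Function.update (Function.update s .num (A.drop i)) .aux (P.take i).reverse)
    (fun _ => []) (fun _ => []) (fun i hi => ?_) r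
  · refine (Trans.seq h1 (fun r => trans_move (k := .aux) (k' := .num) (by decide) (by decide)
      (by decide) r _)).congr ?_ ?_ ?_ ?_ |>.mono ?_
    · funext j
      cases j <;> simp [hs, hs2, ← hA]
    · simp
    · simp
    · rw [← hPl, List.take_length]
      have : A.drop P.length = [] := List.drop_eq_nil_of_le (by omega)
      funext j
      cases j <;> simp [hs, hs2, this]
    · rw [← hPl, List.take_length]
      simp; lia
  · refine trans_pop_ite (t := 1) (by decide) ?_
    have hiP : i < P.length := by omega
    rw [List.take_succ_eq_append_getElem hiP]
    by_cases hiA : i < A.length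
    · have e1 : P[i] = A[i] := by simp [hP, hiA]
      have e2 : A.drop i = A[i] :: A.drop (i + 1) := by simp
      have h2 := fun s => trans_copy (k := .aux) (by decide) A[i] s
      simp only [Function.update_apply, e2]
      refine (h2 _).congr rfl rfl rfl ?_
      funext j
      cases j <;> simp [e1]
    · have e1 : P[i] = Γ'.bit false := by simp [hP, List.getElem_append, hiA]
      have e2 : A.drop i = [] := by simp; omega
      have e3 : A.drop (i + 1) = [] := by simp; omega
      have h2 := fun r s => trans_put (k := .aux) (by decide) [Γ'.bit false] r s
      simp only [Function.update_apply, e2, e3]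
      refine (h2 _ _).congr rfl rfl rfl ?_
      funext j
      cases j <;> simp [e1]

/-- Increment the binary number on the stack `den`. -/
def Cmd.inc : Cmd Stack :=
  .loop .den (· == some (Γ'.bit true)) (.put .aux [Γ'.bit false]) ;;
    (.put .den [Γ'.bit true] ;; .each .aux (.copy .den))

/-- The loop replaces the trailing ones by zeros, which it collects on `aux`, and drops the zero
that follows them. -/
theorem trans_inc_carry {s : Ctx} (l : List Bool) (z : List Γ') (r) :
    ∃ k tl, incBits l = List.replicate k false ++ true :: tl ∧ k ≤ l.length ∧
      Trans (.loop .den (· == some (Γ'.bit true)) (.put .aux [Γ'.bit false])) r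
        (Function.update (Function.update s .aux z) .den (l.map Γ'.bit)) [] []
        (Function.update (Function.update s .aux (List.replicate k (Γ'.bit false) ++ z)) .den
          (tl.map Γ'.bit)) (2 * l.length + 1) := by
  have hden : Inner Stack.den := by decide
  induction l generalizing z r with
  | nil =>
    refine ⟨0, [], by simp [incBits], by simp, fun u v => ?_⟩
    have h1 := Run.loop_exit (k := .den) (p := (· == some (Γ'.bit true)))
      (c := .put .aux [Γ'.bit false]) (r := r) (s := io (Function.update (Function.update s .aux z)
        .den []) u v) (by simp [io_inner hden]) (le_refl 1)
    rw [update_io hden, io_inner hden] at h1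
    exact ⟨_, by simpa using h1⟩
  | cons b l ih =>
    cases b with
    | false =>
      refine ⟨0, l, by simp [incBits], by simp, fun u v => ?_⟩
      have h1 := Run.loop_exit (k := .den) (p := (· == some (Γ'.bit true)))
        (c := .put .aux [Γ'.bit false]) (r := r) (s := io (Function.update
          (Function.update s .aux z) .den ((false :: l).map Γ'.bit)) u v)
        (by simp [io_inner hden]) (le_refl 1)
      rw [update_io hden, io_inner hden] at h1
      exact ⟨_, by simpa using h1.mono (t' := 2 * (l.length + 1) + 1) (by omega)⟩
    | true =>
      obtain ⟨k, tl, h1, h2, h3⟩ := ih (Γ'.bit false :: z) (some (Γ'.bit true))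
      refine ⟨k + 1, tl, by simp [incBits, h1, List.replicate_succ], by simpa using h2,
        fun u v => ?_⟩
      obtain ⟨r', h4⟩ := h3 u v
      have h5 := Run.put (k := .aux) (l := [Γ'.bit false]) (r := some (Γ'.bit true))
        (s := io (Function.update (Function.update s .aux z) .den (l.map Γ'.bit)) u v) (le_refl 1)
      have hrep : List.replicate (k + 1) (Γ'.bit false) ++ z =
          List.replicate k (Γ'.bit false) ++ Γ'.bit false :: z := by simp [List.replicate_succ']
      refine ⟨r', Run.loop_step (t₁ := 1) (t₂ := 2 * l.length + 1) (r₁ := some (Γ'.bit true)) ?_ ?_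
        (by rw [hrep]; exact h4)
        (by simp only [List.length_cons]; lia)⟩
      · simp [io_inner hden]
      · rw [io_inner hden, update_io hden]
        rw [update_io (by decide), io_inner (by decide)] at h5
        simpa [Function.update_comm (show Stack.aux ≠ .den by decide)] using h5

theorem trans_inc {s : Ctx} (hs : s .aux = []) (n : ℕ) (hn : s .den = bitWord n) (r) :
    Trans .inc r s [] [] (Function.update s .den (bitWord (n + 1))) (4 * n.size + 3) := by
  obtain ⟨k, tl, h1, h2, h3⟩ := trans_inc_carry (s := s) n.bits [] r
  have h4 := fun r => (trans_put (k := .den) (by decide) [Γ'.bit true] r _).seq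
    (s := (Function.update (Function.update s .aux (List.replicate k (Γ'.bit false) ++ [])) .den
          (tl.map Γ'.bit))) (fun r => trans_move (k := .aux) (k' := .den) (by decide) (by decide)
      (by decide) r _)
  refine (Trans.seq h3 h4).congr ?_ rfl rfl ?_ |>.mono ?_
  · have : n.bits.map Γ'.bit = s .den := hn.symm
    rw [this]
    funext j
    cases j <;> simp [hs]
  · funext j
    cases j <;> simp [hs, bitWord, bits_succ, h1]
  · rw [Nat.size_eq_bits_len] at *
    simp; lia

/-! ### The transition probabilities of the reduction -/

/-- The fraction `0 / 1`. -/
def zeroFrac : Frac := (0, 1)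

/-- The fraction `1 / 2 ^ j`. -/
def dyadic (j : ℕ) : Frac := (1, ⟨2 ^ j, by positivity⟩)

/-- The common denominator `2 ^ j * (2 * (2 ^ m * b) + a)` of the two probabilities for the
weight `± a / b`. -/
def edgeDen (m j a : ℕ) (b : ℕ+) : ℕ+ :=
  ⟨2 ^ j * (2 ^ (m + 1) * b + a), by have := b.pos; positivity⟩

/-- The smaller probability for the weight `± a / b`, with numerator `2 ^ m * b`. -/
def edgeLow (m j a : ℕ) (b : ℕ+) : Frac := (((2 ^ m * b : ℕ) : ℤ), edgeDen m j a b)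

/-- The larger probability for the weight `± a / b`, with numerator `2 ^ m * b + a`. -/
def edgeHigh (m j a : ℕ) (b : ℕ+) : Frac := (((2 ^ m * b + a : ℕ) : ℤ), edgeDen m j a b)

/-- The probabilities, which add up to `1 / 2 ^ j`, of following an edge with the given sign,
numerator and denominator of its weight, and of going astray instead. -/
def edgeMass (m j : ℕ) (neg : Bool) (a : ℕ) (b : ℕ+) : Frac × Frac :=
  bif neg then (edgeHigh m j a b, edgeLow m j a b) else (edgeLow m j a b, edgeHigh m j a b)

/-- As `edgeMass`, for an entry of a weight matrix. -/
def cellMass (m j : ℕ) : Option Frac → Frac × Frac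
  | none => (zeroFrac, dyadic j)
  | some q => edgeMass m j (decide (q.1 < 0)) q.1.natAbs q.2

/-- The encoding of two fractions, one after the other. -/
def encPair (c : Frac × Frac) : List Γ' := encFrac c.1 ++ encFrac c.2

theorem encFrac_natCast (a : ℕ) (d : ℕ+) :
    encFrac ((a : ℤ), d) =
      [Γ'.bit false] ++ (bitWord a ++ ([Γ'.comma] ++ (bitWord d ++ [Γ'.comma]))) := by
  simp [encFrac, encNat_eq]

theorem bitWord_zero : bitWord 0 = [] := by simp [bitWord]

theorem encFrac_zeroFrac : encFrac zeroFrac = [Γ'.bit false, Γ'.comma, Γ'.bit true, Γ'.comma] := by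
  have := encFrac_natCast 0 1
  rw [zeroFrac]
  simpa [bitWord_zero, bitWord_one] using this

theorem encFrac_dyadic (j : ℕ) :
    encFrac (dyadic j) = [Γ'.bit false, Γ'.bit true, Γ'.comma] ++
      (List.replicate j (Γ'.bit false) ++ [Γ'.bit true, Γ'.comma]) := by
  have := encFrac_natCast 1 ⟨2 ^ j, by positivity⟩
  have h2 := bitWord_pow_mul j one_pos
  rw [mul_one] at h2
  rw [dyadic]
  simpa [bitWord_one, h2] using this

/-- A binary number padded with zeros to `m` digits. -/
def padWord (m a : ℕ) : List Γ' := bitWord a ++ List.replicate (m - a.size) (Γ'.bit false)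

theorem bitWord_edgeDen (m j : ℕ) {a : ℕ} (b : ℕ+) (ha : a.size ≤ m) :
    bitWord (edgeDen m j a b) = List.replicate j (Γ'.bit false) ++
      (padWord m a ++ ([Γ'.bit false] ++ bitWord b)) := by
  have h1 : 0 < 2 ^ (m + 1) * (b : ℕ) + a := by have := b.pos; positivity
  have h2 : 2 ^ (m + 1) * (b : ℕ) + a = 2 ^ m * (2 ^ 1 * b) + a := by ring
  have h3 := b.pos
  rw [edgeDen, PNat.mk_coe, bitWord_pow_mul j h1, h2, bitWord_pow_mul_add m (by positivity) a ha,
    bitWord_pow_mul 1 h3]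
  simp [padWord]

/-! ### Emitting one weight -/

/-- Emit `2 ^ m * b`. -/
def Cmd.emitLow : Cmd Stack := .fill .len .aux [Γ'.bit false] ;; .emit .den .aux

/-- Emit `2 ^ m * b + a`. -/
def Cmd.emitHigh : Cmd Stack := .emit .num .aux ;; .emit .den .aux

/-- Emit the common denominator. -/
def Cmd.emitDen : Cmd Stack :=
  .fill .done .aux [Γ'.bit false] ;; (.emit .num .aux ;; (.put .w [Γ'.bit false] ;; .emit .den .aux))

/-- Emit a fraction with the numerator that the given program emits. -/
def Cmd.emitFrac (c : Cmd Stack) : Cmd Stack :=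
  .put .w [Γ'.bit false] ;; (c ;; (.put .w [Γ'.comma] ;; (.emitDen ;; .put .w [Γ'.comma])))

/-- Emit the two probabilities for the current weight. -/
def Cmd.emitPair : Cmd Stack :=
  .pop .sgn ;; .ite (· == some (Γ'.bit true))
    (.put .sgn [Γ'.bit true] ;; (.emitFrac .emitHigh ;; .emitFrac .emitLow))
    (.put .sgn [Γ'.bit false] ;; (.emitFrac .emitLow ;; .emitFrac .emitHigh))

/-- The stacks hold the weight `± a / b` and the parameters `m` and `j` of `edgeMass`. -/
structure Loaded (m j : ℕ) (neg : Bool) (a : ℕ) (b : ℕ+) (s : Ctx) : Prop where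
  aux : s .aux = []
  len : (s .len).length = m
  done : (s .done).length = j
  sgn : s .sgn = [Γ'.bit neg]
  num : s .num = padWord m a
  den : s .den = bitWord b
  size_num : a.size ≤ m
  size_den : (b : ℕ).size ≤ m

theorem length_padWord {m a : ℕ} (h : a.size ≤ m) : (padWord m a).length = m := by
  simp [padWord, length_bitWord]; omega

theorem flatten_replicate_singleton {α : Type*} (n : ℕ) (x : α) :
    (List.replicate n [x]).flatten = List.replicate n x := by
  induction n <;> simp_all [List.replicate_succ]

theorem trans_zeros {k : Stack} (hk : Inner k) (hne : k ≠ .aux) {s : Ctx} (hs : s .aux = []) (r) :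
    Trans (.fill k .aux [Γ'.bit false]) r s [] (List.replicate (s k).length (Γ'.bit false)) s
      ((s k).length * 5 + 2) :=
  (trans_fill hk (by decide) hne hs _ r).congr rfl rfl (flatten_replicate_singleton _ _) rfl

section

variable {m j : ℕ} {neg : Bool} {a : ℕ} {b : ℕ+} {s : Ctx}

theorem Loaded.trans_emit_num (h : Loaded m j neg a b s) (r) :
    Trans (.emit .num .aux) r s [] (padWord m a) s (m * 5 + 2) := by
  have := trans_emit (k := .num) (k' := .aux) (by decide) (by decide) (by decide) h.aux r
  rwa [h.num, length_padWord h.size_num] at this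

theorem Loaded.trans_emit_den (h : Loaded m j neg a b s) (r) :
    Trans (.emit .den .aux) r s [] (bitWord b) s (m * 5 + 2) := by
  have := trans_emit (k := .den) (k' := .aux) (by decide) (by decide) (by decide) h.aux r
  rw [h.den] at this
  refine this.mono ?_
  have := h.size_den
  rw [length_bitWord]; omega

theorem Loaded.trans_emitDen (h : Loaded m j neg a b s) (r) :
    Trans .emitDen r s [] (bitWord (edgeDen m j a b)) s (m * 10 + j * 5 + 7) := by
  refine (Trans.seq (trans_zeros (by decide) (by decide) h.aux r) fun r =>
    (h.trans_emit_num r).seq fun r => (trans_put_w _ r s).seq fun r =>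
    h.trans_emit_den r).congr rfl (by simp) ?_ rfl |>.mono ?_
  · rw [bitWord_edgeDen m j b h.size_num, h.done]
  · rw [h.done]; omega

theorem Loaded.trans_emitFrac (h : Loaded m j neg a b s) {c : Cmd Stack} {x : ℕ}
    (hc : ∀ r, Trans c r s [] (bitWord x) s (m * 10 + 4)) (r) :
    Trans (.emitFrac c) r s [] (encFrac ((x : ℤ), edgeDen m j a b)) s (m * 20 + j * 5 + 14) := by
  refine (Trans.seq (trans_put_w _ r s) fun r => (hc r).seq fun r =>
    (trans_put_w _ r s).seq fun r => (h.trans_emitDen r).seq fun r =>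
    trans_put_w _ r s).congr rfl (by simp) ?_ rfl |>.mono ?_
  · rw [encFrac_natCast]
  · omega

theorem Loaded.trans_emitFrac_low (h : Loaded m j neg a b s) (r) :
    Trans (.emitFrac .emitLow) r s [] (encFrac (edgeLow m j a b)) s (m * 20 + j * 5 + 14) := by
  refine h.trans_emitFrac (fun r => ?_) r
  refine (Trans.seq (trans_zeros (k := .len) (by decide) (by decide) h.aux r) fun r =>
    h.trans_emit_den r).congr rfl (by simp) ?_ rfl |>.mono ?_
  · rw [bitWord_pow_mul m b.pos, h.len]
  · rw [h.len]; omega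

theorem Loaded.trans_emitFrac_high (h : Loaded m j neg a b s) (r) :
    Trans (.emitFrac .emitHigh) r s [] (encFrac (edgeHigh m j a b)) s (m * 20 + j * 5 + 14) := by
  refine h.trans_emitFrac (fun r => ?_) r
  refine (Trans.seq (h.trans_emit_num r) fun r =>
    h.trans_emit_den r).congr rfl (by simp) ?_ rfl |>.mono ?_
  · rw [bitWord_pow_mul_add m b.pos a h.size_num]; rfl
  · omega

theorem Loaded.trans_emitPair (h : Loaded m j neg a b s) (r) :
    Trans .emitPair r s [] (encPair (edgeMass m j neg a b)) s (m * 40 + j * 10 + 31) := by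
  have hs : Function.update (Function.update s .sgn []) .sgn [Γ'.bit neg] = s := by
    rw [Function.update_idem, ← h.sgn, Function.update_eq_self]
  refine (trans_pop_ite (t := m * 40 + j * 10 + 29) (by decide) ?_)
  rw [h.sgn]
  have h1 := fun r => trans_put (k := .sgn) (by decide) [Γ'.bit neg] r (Function.update s .sgn [])
  simp only [Function.update_self, List.reverse_singleton, List.append_nil, hs] at h1
  cases neg with
  | true =>
    exact (Trans.seq (h1 _) fun r => (h.trans_emitFrac_high r).seq fun r =>
      h.trans_emitFrac_low r).mono (by omega)
  | false =>
    exact (Trans.seq (h1 _) fun r => (h.trans_emitFrac_low r).seq fun r =>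
      h.trans_emitFrac_high r).mono (by omega)

end

/-! ### Processing one entry of the weight matrix -/

/-- Read a numerator and a denominator. -/
def Cmd.readNumDen : Cmd Stack := .readNat .num ;; (.pad ;; .readNat .den)

/-- Forget the current weight. -/
def Cmd.unload : Cmd Stack :=
  .each .sgn (.put .w []) ;; (.each .num (.put .w []) ;; .each .den (.put .w []))

/-- Emit the two probabilities for a missing edge. -/
def Cmd.emitNone : Cmd Stack :=
  .put .w [Γ'.bit false, Γ'.comma, Γ'.bit true, Γ'.comma] ;;
    (.put .w [Γ'.bit false, Γ'.bit true, Γ'.comma] ;;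
      (.fill .done .aux [Γ'.bit false] ;; .put .w [Γ'.bit true, Γ'.comma]))

/-- Read an entry of the weight matrix and emit the two probabilities. -/
def Cmd.cell : Cmd Stack :=
  .pop .inp ;; .ite (· == some Γ'.blank) .emitNone
    (.copy .sgn ;; (.readNumDen ;; (.emitPair ;; .unload)))

/-- No weight is loaded; `m` and `j` are the parameters of `cellMass`. -/
structure Idle (m j : ℕ) (s : Ctx) : Prop where
  aux : s .aux = []
  aux2 : s .aux2 = []
  len : (s .len).length = m
  done : (s .done).length = j
  sgn : s .sgn = []
  num : s .num = []
  den : s .den = []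

/-- The contents of the stacks with a weight loaded. -/
def load (m : ℕ) (neg : Bool) (a : ℕ) (b : ℕ+) (s : Ctx) : Ctx :=
  Function.update (Function.update (Function.update s .sgn [Γ'.bit neg]) .num (padWord m a))
    .den (bitWord b)

section

variable {m j : ℕ} {neg : Bool} {a : ℕ} {b : ℕ+} {s : Ctx}

theorem Idle.loaded (h : Idle m j s) (ha : a.size ≤ m) (hb : (b : ℕ).size ≤ m) :
    Loaded m j neg a b (load m neg a b s) where
  aux := by simp [load, h.aux]
  len := by simp [load, h.len]
  done := by simp [load, h.done]
  sgn := by simp [load]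
  num := by simp [load]
  den := by simp [load]
  size_num := ha
  size_den := hb

theorem Idle.trans_readNumDen (h : Idle m j s) (ha : a.size ≤ m) (hb : (b : ℕ).size ≤ m) (r) :
    Trans .readNumDen r (Function.update s .sgn [Γ'.bit neg]) (encNat a ++ encNat b) []
      (load m neg a b s) (m * 17 + 7) := by
  have hl := length_bitWord a
  refine (Trans.seq (trans_readNat (k := .num) (by decide) (by decide) ?_ a r) fun r =>
    (trans_pad ?_ ?_ ?_ r).seq fun r =>
    trans_readNat (k := .den) (by decide) (by decide) ?_ b r).congr rfl (by simp) (by simp) ?_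
    |>.mono ?_
  · simp [h.aux]
  · simp [h.aux]
  · simp [h.aux2]
  · simp [h.num, h.len, hl, ha]
  · simp [h.aux]
  · funext k
    cases k <;> simp [load, h.num, h.den, h.len, hl, padWord]
  · simp [h.len]; omega

theorem Idle.trans_unload (h : Idle m j s) (ha : a.size ≤ m) (hb : (b : ℕ).size ≤ m) (r) :
    Trans .unload r (load m neg a b s) [] [] s (m * 4 + 5) := by
  have hl := length_bitWord b
  have hl2 := length_padWord ha
  refine (Trans.seq (trans_clear (by decide) r _) fun r => (trans_clear (by decide) r _).seq
    fun r => trans_clear (by decide) r _).congr rfl rfl rfl ?_ |>.mono ?_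
  · funext k
    cases k <;> simp [load, h.num, h.den, h.sgn]
  · simp [load, hl, hl2]; omega

theorem Idle.trans_emitNone (h : Idle m j s) (r) :
    Trans .emitNone r s [] (encPair (cellMass m j none)) s (j * 5 + 5) := by
  refine (Trans.seq (trans_put_w _ r s) fun r => (trans_put_w _ r s).seq fun r =>
    (trans_zeros (k := .done) (by decide) (by decide) h.aux r).seq fun r =>
    trans_put_w _ r s).congr rfl rfl ?_ rfl |>.mono ?_
  · rw [encPair, cellMass, encFrac_zeroFrac, encFrac_dyadic, h.done]
  · rw [h.done]; omega

theorem Idle.trans_cell (h : Idle m j s) (o : Option Frac)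
    (ho : ∀ q ∈ o, q.1.natAbs.size ≤ m ∧ (q.2 : ℕ).size ≤ m) (r) :
    Trans .cell r s (encOptFrac o) (encPair (cellMass m j o)) s (m * 61 + j * 10 + 50) := by
  cases o with
  | none =>
    refine (trans_read_ite (I := []) (t := j * 5 + 5) ?_).mono (by omega)
    exact h.trans_emitNone _
  | some q =>
    obtain ⟨ha, hb⟩ := ho q rfl
    refine (trans_read_ite (t := m * 61 + j * 10 + 44)
      (I := encNat q.1.natAbs ++ encNat (q.2 : ℕ)) ?_).mono (by omega)
    refine (trans_copy_seq (by decide) (t := m * 61 + j * 10 + 43) ?_)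
    rw [h.sgn]
    exact (((h.trans_readNumDen ha hb _).seq fun r => ((h.loaded ha hb).trans_emitPair r).seq
      fun r => h.trans_unload ha hb r).congr rfl (by simp) (by simp [cellMass]) rfl).mono (by omega)

end

/-! ### The parts of the output word -/

/-- The end of the row of a vertex: no transition into the additional vertex, and the
remaining probability. -/
def rowEndWord (n : ℕ) : List Γ' := encFrac zeroFrac ++ encFrac (dyadic n)

/-- The row of a state that stands for having gone astray. -/
def sinkWord (n : ℕ) : List Γ' :=
  encFrac (dyadic 0) ++ ((List.replicate n (encFrac zeroFrac ++ encFrac zeroFrac)).flatten ++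
    encFrac zeroFrac)

/-- The row of a vertex with the given weights of its edges, and the row of the sink that
belongs to it. -/
def rowsWord (m n : ℕ) (w : ℕ → Option Frac) : List Γ' :=
  (List.range n).flatMap (fun j => encPair (cellMass m (j + 1) (w j))) ++
    (rowEndWord n ++ sinkWord n)

/-- The encoding of the list of the states `0, 2, …, 2 n`. -/
def indicesWord (n : ℕ) : List Γ' :=
  (List.range (n + 1)).flatMap (fun i => Γ'.comma :: encUnary (2 * i)) ++ [Γ'.ket]

/-- The exponent of the power of two that every order of the vertices contributes. -/
def expo (n : ℕ) : ℕ := ∑ j ∈ Finset.range n, (j + 2)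

/-- The denominator of the threshold. -/
def thresholdDen (n k : ℕ) : ℕ+ := ⟨2 ^ k * (2 ^ expo n * (2 ^ 1 * (n + 1))), by positivity⟩

/-- The threshold `(1 - 2⁻ᵏ) / (2 ^ expo n * N)`, where `N = 2 * (n + 1)` is the number of states. -/
def threshold (n k : ℕ) : Frac :=
  (((2 ^ k - 1 : ℕ) : ℤ), thresholdDen n k)

theorem encFrac_threshold (n k : ℕ) : encFrac (threshold n k) =
    [Γ'.bit false] ++ (List.replicate k (Γ'.bit true) ++ ([Γ'.comma] ++
      (List.replicate k (Γ'.bit false) ++ (List.replicate (expo n) (Γ'.bit false) ++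
        ([Γ'.bit false] ++ (bitWord (n + 1) ++ [Γ'.comma])))))) := by
  rw [threshold, encFrac_natCast, bitWord_two_pow_sub_one, thresholdDen, PNat.mk_coe,
    bitWord_pow_mul k (by positivity), bitWord_pow_mul (expo n) (by positivity),
    bitWord_pow_mul 1 (by positivity)]
  simp

/-! ### The program of the reduction -/

/-- Emit the end of the row of a vertex and the row of its sink. -/
def Cmd.closeRow : Cmd Stack :=
  (.put .w (encFrac zeroFrac) ;; (.put .w [Γ'.bit false, Γ'.bit true, Γ'.comma] ;;
    (.fill .col .aux [Γ'.bit false] ;; .put .w [Γ'.bit true, Γ'.comma]))) ;;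
  (.put .w (encFrac (dyadic 0)) ;; (.fill .col .aux (encFrac zeroFrac ++ encFrac zeroFrac) ;;
    .put .w (encFrac zeroFrac)))

/-- Read the weight matrix and emit the rows of the vertices and their sinks. -/
def Cmd.rows : Cmd Stack := .scan .row .rowd (.scan .col .done .cell ;; .closeRow)

/-- Read the bound of the path, and emit the rows of the additional vertex and its sink. -/
def Cmd.lastRow : Cmd Stack :=
  (.pop .inp ;; .ite (· == some (Γ'.bit true)) (.put .sgn [Γ'.bit false])
    (.put .sgn [Γ'.bit true])) ;;
  (.readNumDen ;; (.scan .col .done .emitPair ;; (.closeRow ;; .unload)))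

/-- Emit the list of the states of the vertices. -/
def Cmd.indices : Cmd Stack :=
  .put .w [Γ'.comma, Γ'.ket] ;;
    (.scan .col .done (.put .w [Γ'.comma] ;;
      (.fill .done .aux [Γ'.bit true, Γ'.bit true] ;; .put .w [Γ'.ket])) ;; .put .w [Γ'.ket])

/-- Write the number of vertices plus one in binary. -/
def Cmd.count : Cmd Stack := .put .den [Γ'.bit true] ;; .scan .col .done .inc

/-- Emit the threshold. -/
def Cmd.bound : Cmd Stack :=
  .put .w [Γ'.bit false] ;; (.fill .thr .aux [Γ'.bit true] ;; (.put .w [Γ'.comma] ;;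
    (.fill .thr .aux [Γ'.bit false] ;;
      (.scan .col .done (.fill .done .aux [Γ'.bit false] ;; .put .w [Γ'.bit false]) ;;
        (.put .w [Γ'.bit false] ;; (.count ;; (.emit .den .aux ;; (.put .w [Γ'.comma] ;;
          .each .den (.put .w [])))))))))

/-- Read the number of vertices and emit the number of states. -/
def Cmd.header : Cmd Stack :=
  .loop .inp isBit (.copy .row ;; .copy .col) ;;
    (.put .w [Γ'.bit true, Γ'.bit true] ;;
      (.fill .col .aux [Γ'.bit true, Γ'.bit true] ;; .put .w [Γ'.ket]))

/-- Empty the stacks that hold parameters. -/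
def Cmd.cleanup : Cmd Stack :=
  .each .row (.put .w []) ;; (.each .col (.put .w []) ;;
    (.each .len (.put .w []) ;; .each .thr (.put .w [])))

/-- The part of the program that reads the input and produces the output in reverse order. -/
def Cmd.body : Cmd Stack :=
  .header ;; (.rows ;; (.lastRow ;; (.indices ;; (.bound ;; .cleanup))))

/-- Measure the length of the input. -/
def Cmd.prepare : Cmd Stack :=
  .each .inp (.copy .aux ;; (.put .len (List.replicate 6 (Γ'.bit true)) ;;
    .put .thr (List.replicate 8 (Γ'.bit true)))) ;; .each .aux (.copy .inp)

/-- The program of the reduction. -/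
def Cmd.reduction : Cmd Stack := .prepare ;; (.body ;; .each .w (.copy .out))

/-! ### Correctness of the program -/

/-- The contents of the stacks between the parts of the program, where `n` is the number of vertices
and `m`, `k` are the exponents of the powers of two used for the weights and the threshold. -/
structure Frame (n m k : ℕ) (s : Ctx) : Prop where
  aux : s .aux = []
  aux2 : s .aux2 = []
  done : s .done = []
  sgn : s .sgn = []
  num : s .num = []
  den : s .den = []
  len : (s .len).length = m
  thr : (s .thr).length = k
  col : (s .col).length = n

section

variable {n m k : ℕ} {s : Ctx}

theorem trans_closeRow (ha : s .aux = []) (hc : (s .col).length = n) (r) :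
    Trans .closeRow r s [] (rowEndWord n ++ sinkWord n) s (n * 10 + 9) := by
  refine (Trans.seq ((trans_put_w _ r s).seq fun r => (trans_put_w _ r s).seq fun r =>
    (trans_zeros (k := .col) (by decide) (by decide) ha r).seq fun r => trans_put_w _ r s) fun r =>
    (trans_put_w _ r s).seq fun r => (trans_fill (k := .col) (by decide) (by decide) (by decide) ha
      _ r).seq fun r => trans_put_w _ r s).congr rfl rfl ?_ rfl |>.mono ?_
  · rw [rowEndWord, sinkWord, hc, encFrac_dyadic n]
  · rw [hc]; omega

theorem Frame.trans_scan_cell (h : Frame n m k s) (w : ℕ → Option Frac)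
    (hw : ∀ j < n, ∀ q ∈ w j, q.1.natAbs.size ≤ m ∧ (q.2 : ℕ).size ≤ m) (r) :
    Trans (.scan .col .done .cell) r s ((List.range n).flatMap fun j => encOptFrac (w j))
      ((List.range n).flatMap fun j => encPair (cellMass m (j + 1) (w j))) s
      (n * (m * 61 + n * 10 + 54) + 2) := by
  have h1 := trans_scan_const (k := .col) (k' := .done) (s := s) (c := .cell)
    (t := m * 61 + n * 10 + 50) (by decide) (by decide) (by decide) h.done
    (fun j => encOptFrac (w j)) (fun j => encPair (cellMass m (j + 1) (w j))) (fun i hi => ?_) r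
  · rw [h.col] at h1
    exact h1.mono (by lia)
  · rw [h.col] at hi
    refine (Idle.trans_cell (j := i + 1) ⟨?_, ?_, ?_, ?_, ?_, ?_, ?_⟩ (w i) (hw i hi) _).mono
      (by omega)
    all_goals simp [h.aux, h.aux2, h.len, h.sgn, h.num, h.den, h.col]
    omega

theorem Frame.trans_rows (h : Frame n m k s) (hrow : (s .row).length = n) (hrowd : s .rowd = [])
    (W : ℕ → ℕ → Option Frac)
    (hW : ∀ i < n, ∀ j < n, ∀ q ∈ W i j, q.1.natAbs.size ≤ m ∧ (q.2 : ℕ).size ≤ m) (r) :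
    Trans .rows r s
      ((List.range n).flatMap fun i => (List.range n).flatMap fun j => encOptFrac (W i j))
      ((List.range n).flatMap fun i => rowsWord m n (W i)) s
      (n * (n * (m * 61 + n * 10 + 64) + 15) + 2) := by
  have h1 := trans_scan_const (k := .row) (k' := .rowd) (s := s)
    (c := .scan .col .done .cell ;; .closeRow)
    (t := n * (m * 61 + n * 10 + 64) + 11) (by decide) (by decide) (by decide) hrowd
    (fun i => (List.range n).flatMap fun j => encOptFrac (W i j))
    (fun i => rowsWord m n (W i)) (fun i hi => ?_) r
  · rw [hrow] at h1
    exact h1.mono (by lia)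
  · rw [hrow] at hi
    refine (Trans.seq (Frame.trans_scan_cell (n := n) (m := m) (k := k) ?_ (W i) (hW i hi) _)
      fun r => trans_closeRow (n := n) ?_ ?_ r).congr rfl (by simp) rfl rfl |>.mono (by lia)
    · constructor <;> simp [h.aux, h.aux2, h.len, h.sgn, h.num, h.den, h.col, h.done, h.thr]
    · simp [h.aux]
    · simp [h.col]

/-- Flipping the sign bit negates the weight; for the weight `0` both signs give the same pair. -/
theorem edgeMass_neg (m j : ℕ) (c : ℤ) (d : ℕ+) :
    edgeMass m j (!decide (c < 0)) c.natAbs d = cellMass m j (some (-c, d)) := by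
  rcases lt_trichotomy c 0 with h | rfl | h
  · simp [cellMass, h, not_lt.2 h.le]
  · simp [cellMass, edgeMass, edgeLow, edgeHigh]
  · simp [cellMass, h, not_lt.2 h.le]

theorem Frame.trans_lastRow (h : Frame n m k s) (C : Frac) (hC : C.1.natAbs.size ≤ m)
    (hC2 : (C.2 : ℕ).size ≤ m) (r) :
    Trans .lastRow r s (encFrac C) (rowsWord m n fun _ => some (-C.1, C.2)) s
      (n * (m * 40 + n * 10 + 45) + m * 21 + 26) := by
  obtain ⟨c, d⟩ := C
  have hI : Idle m 0 s := ⟨h.aux, h.aux2, h.len, by simp [h.done], h.sgn, h.num, h.den⟩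
  set neg := !decide (c < 0) with hneg
  set s' := load m neg c.natAbs d s with hs'
  have h1 : ∀ r, Trans (.pop .inp ;; .ite (· == some (Γ'.bit true)) (.put .sgn [Γ'.bit false])
      (.put .sgn [Γ'.bit true])) r s [Γ'.bit (decide (c < 0))] []
      (Function.update s .sgn [Γ'.bit neg]) 3 := by
    intro r
    refine trans_read_ite (t := 1) ?_
    have h2 := fun b r => trans_put (k := .sgn) (by decide) [Γ'.bit b] r s
    simp only [h.sgn] at h2
    by_cases hc : c < 0
    · simpa [hneg, hc] using h2 false _
    · have e : (some (Γ'.bit false) == some (Γ'.bit true)) = false := rfl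
      simpa [hneg, hc, e] using h2 true _
  have h3 : ∀ r, Trans (.scan .col .done .emitPair) r s' []
      ((List.range n).flatMap fun j => encPair (cellMass m (j + 1) (some (-c, d)))) s'
      (n * (m * 40 + n * 10 + 35) + 2) := by
    intro r
    have hcol : (s' .col).length = n := by simp [hs', load, h.col]
    have h1 := trans_scan_const (k := .col) (k' := .done) (s := s') (c := .emitPair)
      (t := m * 40 + n * 10 + 31) (by decide) (by decide) (by decide) (by simp [hs', load, h.done])
      (fun j => []) (fun j => encPair (cellMass m (j + 1) (some (-c, d)))) (fun i hi => ?_) r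
    · rw [hcol] at h1
      exact h1.congr rfl (by simp) rfl rfl |>.mono (by lia)
    · rw [hcol] at hi
      refine (Loaded.trans_emitPair (m := m) (j := i + 1) (neg := neg) (a := c.natAbs) (b := d)
        ⟨?_, ?_, ?_, ?_, ?_, ?_, hC, hC2⟩ _).congr rfl rfl ?_ rfl |>.mono (by omega)
      · simp [hs', load, h.aux]
      · simp [hs', load, h.len]
      · simp [hcol]; omega
      · simp [hs', load]
      · simp [hs', load]
      · simp [hs', load]
      · rw [hneg, edgeMass_neg]
  refine (Trans.seq (h1 r) fun r => (hI.trans_readNumDen hC hC2 r).seq fun r => (h3 r).seq fun r =>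
    (trans_closeRow (n := n) ?_ ?_ r).seq fun r => hI.trans_unload hC hC2 r).congr rfl ?_ ?_ rfl
    |>.mono (by lia)
  · simp [hs', load, h.aux]
  · simp [hs', load, h.col]
  · simp [encFrac]
  · simp [rowsWord]

theorem Frame.trans_indices (h : Frame n m k s) (r) :
    Trans .indices r s [] (indicesWord n) s (n * (n * 5 + 8) + 4) := by
  have h1 : ∀ r, Trans (.scan .col .done (.put .w [Γ'.comma] ;;
      (.fill .done .aux [Γ'.bit true, Γ'.bit true] ;; .put .w [Γ'.ket]))) r s []
      ((List.range n).flatMap fun j => Γ'.comma :: encUnary (2 * (j + 1))) s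
      (n * (n * 5 + 8) + 2) := by
    intro r
    have h1 := trans_scan_const (k := .col) (k' := .done) (s := s) (c := .put .w [Γ'.comma] ;;
      (.fill .done .aux [Γ'.bit true, Γ'.bit true] ;; .put .w [Γ'.ket]))
      (t := n * 5 + 4) (by decide) (by decide) (by decide) h.done
      (fun j => []) (fun j => Γ'.comma :: encUnary (2 * (j + 1))) (fun i hi => ?_) r
    · rw [h.col] at h1
      exact h1.congr rfl (by simp) rfl rfl |>.mono (by lia)
    · rw [h.col] at hi
      refine (Trans.seq (trans_put_w _ _ _) fun r => (trans_fill (k := .done) (k' := .aux)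
        (by decide) (by decide) (by decide) ?_ _ r).seq fun r => trans_put_w _ r _).congr
        rfl rfl ?_ rfl |>.mono ?_
      · simp [h.aux]
      · have e : ∀ i, (List.replicate i [Γ'.bit true, Γ'.bit true]).flatten =
            List.replicate (2 * i) (Γ'.bit true) := by
          intro i
          induction i with
          | zero => rfl
          | succ i ih => simp [List.replicate_succ, ih, Nat.mul_succ]
        simp [e, encUnary, h.col, show min (i + 1) n = i + 1 by omega]
      · simp [h.col]; omega
  refine (Trans.seq (trans_put_w _ r s) fun r => (h1 r).seq fun r =>
    trans_put_w _ r s).congr rfl rfl ?_ rfl |>.mono (by omega)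
  simp [indicesWord, List.range_succ_eq_map, List.flatMap_map, encUnary]

theorem Frame.trans_count (h : Frame n m k s) (r) :
    Trans .count r s [] [] (Function.update s .den (bitWord (n + 1))) (n * (4 * n + 7) + 3) := by
  have h1 := fun r => trans_scan (k := .col) (k' := .done) (c := .inc)
    (t := 4 * n + 3) (by decide) (by decide) (by decide) (s .col)
    (fun i => Function.update s .den (bitWord (i + 1))) (fun _ => []) (fun _ => [])
    (fun i hi => ?_) r
  · have h2 := trans_put (k := .den) (by decide) [Γ'.bit true] r s
    refine (h2.seq fun r => (h1 r).congr ?_ rfl rfl ?_).congr rfl (by simp) (by simp) rfl |>.mono ?_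
    · funext j
      cases j <;> simp [h.den, h.done, bitWord_one]
    · funext j
      cases j <;> simp [h.done, h.col]
    · rw [h.col]; lia
  · rw [h.col] at hi
    have hsize : (i + 1).size ≤ n := (Nat.size_le.2 Nat.lt_two_pow_self).trans hi
    refine (trans_inc ?_ (i + 1) ?_ _).congr rfl rfl rfl ?_ |>.mono (by omega)
    · simp [h.aux]
    · simp
    · funext j
      cases j <;> simp

theorem Frame.trans_bound (h : Frame n m k s) (r) :
    Trans .bound r s [] (encFrac (threshold n k)) s (n * (n * 9 + 21) + k * 10 + 24) := by
  have h1 : ∀ r, Trans (.scan .col .done (.fill .done .aux [Γ'.bit false] ;;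
      .put .w [Γ'.bit false])) r s [] (List.replicate (expo n) (Γ'.bit false)) s
      (n * (n * 5 + 7) + 2) := by
    intro r
    have h1 := trans_scan_const (k := .col) (k' := .done) (s := s)
      (c := .fill .done .aux [Γ'.bit false] ;; .put .w [Γ'.bit false])
      (t := n * 5 + 3) (by decide) (by decide) (by decide) h.done
      (fun j => []) (fun j => List.replicate (j + 2) (Γ'.bit false)) (fun i hi => ?_) r
    · rw [h.col] at h1
      refine h1.congr rfl (by simp) ?_ rfl |>.mono (by lia)
      clear * -
      induction n with
      | zero => rfl
      | succ n ih =>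
        rw [List.range_succ, List.flatMap_append, ih, expo, expo, Finset.sum_range_succ]
        simp
    · rw [h.col] at hi
      refine (Trans.seq (trans_zeros (k := .done) (by decide) (by decide) ?_ _) fun r =>
        trans_put_w _ r _).congr rfl rfl ?_ rfl |>.mono ?_
      · simp [h.aux]
      · simp [h.col, show min (i + 1) n = i + 1 by omega, List.replicate_succ']
      · simp [h.col, hi]
  have hd : Function.update s .den (bitWord (n + 1)) .den = bitWord (n + 1) := by simp
  have hsize : (n + 1).size ≤ n + 1 := Nat.size_le.2 Nat.lt_two_pow_self
  refine (Trans.seq (trans_put_w _ r s) fun r => (trans_fill (k := .thr) (k' := .aux)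
    (by decide) (by decide) (by decide) h.aux _ r).seq fun r => (trans_put_w _ r s).seq fun r =>
    (trans_zeros (k := .thr) (by decide) (by decide) h.aux r).seq fun r => (h1 r).seq fun r =>
    (trans_put_w _ r s).seq fun r => (h.trans_count r).seq fun r =>
    (trans_emit (k := .den) (k' := .aux) (by decide) (by decide) (by decide) ?_ r).seq fun r =>
    (trans_put_w _ r _).seq fun r => trans_clear (k := .den) (by decide) r _).congr
    rfl (by simp) ?_ ?_ |>.mono ?_
  · simp [h.aux]
  · rw [encFrac_threshold, hd, h.thr, flatten_replicate_singleton]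
    simp
  · funext j
    cases j <;> simp [h.den]
  · rw [hd, h.thr, length_bitWord]
    lia

theorem Frame.trans_cleanup (h : Frame n m k s) (hrow : (s .row).length = n) (r) :
    Trans .cleanup r s [] [] (Function.update (Function.update (Function.update
      (Function.update s .row []) .col []) .len []) .thr []) (n * 4 + m * 2 + k * 2 + 4) := by
  refine (Trans.seq (trans_clear (by decide) r _) fun r => (trans_clear (by decide) r _).seq
    fun r => (trans_clear (by decide) r _).seq fun r => trans_clear (by decide) r _).congr
    rfl rfl rfl rfl |>.mono ?_
  simp [h.col, h.len, h.thr, hrow]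
  omega

end

/-- A program can lengthen each stack only by a bounded number of symbols per step. Hence the output
has polynomial length, and so it can be reversed in polynomial time. -/
theorem exists_growth (c : Cmd Stack) : ∃ B : ℕ, ∀ {r s r' s' t}, Run c r s r' s' t →
    ∀ k, (s' k).length ≤ (s k).length + t * B := by
  have hpop : ∀ (s : Ctx) (k k' : Stack),
      (Function.update s k (s k).tail k').length ≤ (s k').length := by
    intro s k k'
    by_cases hk : k' = k
    · subst hk; simp
    · simp [hk]
  induction c with
  | put k l =>
    refine ⟨l.length, fun h k' => ?_⟩
    cases h with
    | put ht =>
      have := Nat.mul_le_mul_right l.length ht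
      by_cases hk : k' = k
      · subst hk; simp; omega
      · simp [hk]
  | copy k =>
    refine ⟨1, fun h k' => ?_⟩
    cases h with
    | copy ht =>
      by_cases hk : k' = k
      · subst hk; simp [ht]
      · simp [hk]
  | pop k =>
    refine ⟨0, fun h k' => ?_⟩
    cases h with
    | pop ht => simpa using hpop _ _ _
  | seq c d hc hd =>
    obtain ⟨B₁, h₁⟩ := hc
    obtain ⟨B₂, h₂⟩ := hd
    refine ⟨B₁ + B₂, fun h k' => ?_⟩
    cases h with
    | seq ha hb ht =>
      have := h₁ ha k'
      have := h₂ hb k'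
      have := Nat.mul_le_mul_right (B₁ + B₂) ht
      nlinarith
  | ite p c d hc hd =>
    obtain ⟨B₁, h₁⟩ := hc
    obtain ⟨B₂, h₂⟩ := hd
    refine ⟨B₁ + B₂, fun h k' => ?_⟩
    cases h with
    | ite_true hp ha ht =>
      have := h₁ ha k'
      have := Nat.mul_le_mul_right (B₁ + B₂) ht
      nlinarith
    | ite_false hp ha ht =>
      have := h₂ ha k'
      have := Nat.mul_le_mul_right (B₁ + B₂) ht
      nlinarith
  | loop k p c hc =>
    obtain ⟨B, hB⟩ := hc
    refine ⟨B, fun {r s r' s' t} h k' => ?_⟩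
    generalize hL : Cmd.loop k p c = L at h
    induction h with
    | put | copy | pop | seq | ite_true | ite_false => cases hL
    | loop_exit hp ht =>
      cases hL
      exact (hpop _ _ _).trans (Nat.le_add_right _ _)
    | loop_step hp ha hb ht _ ih =>
      cases hL
      have h1 := hB ha k'
      have h2 := ih rfl
      have h3 := Nat.mul_le_mul_right B ht
      have h4 := h1.trans (Nat.add_le_add_right (hpop _ k k') _)
      nlinarith

section

variable {n m k : ℕ}

/-- The contents of the stacks after the input has been measured. -/
def initCtx (m k : ℕ) : Ctx :=
  Function.update (Function.update (fun _ => []) .len (List.replicate m (Γ'.bit true))) .thr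
    (List.replicate k (Γ'.bit true))

/-- The contents of the stacks after the number of vertices has been read. -/
def mainCtx (n m k : ℕ) : Ctx :=
  Function.update (Function.update (initCtx m k) .row (List.replicate n (Γ'.bit true))) .col
    (List.replicate n (Γ'.bit true))

theorem frame_mainCtx (n m k : ℕ) : Frame n m k (mainCtx n m k) := by
  constructor <;> simp [mainCtx, initCtx]

theorem trans_header (n m k : ℕ) (r) :
    Trans .header r (initCtx m k) (encUnary n) (encUnary (2 * (n + 1))) (mainCtx n m k)
      (n * 8 + 5) := by
  have h1 := trans_loop_isBit (c := .copy .row ;; .copy .col) Γ'.ket rfl (List.replicate n true)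
    (fun i => mainCtx i m k) 2 (fun i hi => ?_) r
  · have hf := frame_mainCtx n m k
    refine (Trans.seq h1 fun r => (trans_put_w _ r _).seq fun r => (trans_fill (k := .col)
      (k' := .aux) (by decide) (by decide) (by decide) ?_ _ r).seq fun r =>
      trans_put_w _ r _).congr ?_ ?_ ?_ ?_ |>.mono ?_
    · simp [hf.aux]
    · funext j
      cases j <;> simp [mainCtx, initCtx]
    · simp [encUnary]
    · have e : ∀ i, (List.replicate i [Γ'.bit true, Γ'.bit true]).flatten =
          List.replicate (2 * i) (Γ'.bit true) := by
        intro i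
        induction i with
        | zero => rfl
        | succ i ih => simp [List.replicate_succ, ih, Nat.mul_succ]
      simp [e, hf.col, encUnary, Nat.mul_succ, List.replicate_succ]
    · simp
    · simp [hf.col]; lia
  · refine (trans_copy_seq (by decide) (trans_copy (k := .col) (by decide) _ _)).congr rfl rfl rfl ?_
    funext j
    cases j <;> simp [mainCtx, List.replicate_succ]

/-- The output word. -/
def outWord (m k n : ℕ) (W : ℕ → ℕ → Option Frac) (C : Frac) : List Γ' :=
  encUnary (2 * (n + 1)) ++ (((List.range n).flatMap fun i => rowsWord m n (W i)) ++
    (rowsWord m n (fun _ => some (-C.1, C.2)) ++ (indicesWord n ++ encFrac (threshold n k))))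

theorem trans_body (W : ℕ → ℕ → Option Frac) (C : Frac)
    (hW : ∀ i < n, ∀ j < n, ∀ q ∈ W i j, q.1.natAbs.size ≤ m ∧ (q.2 : ℕ).size ≤ m)
    (hC : C.1.natAbs.size ≤ m) (hC2 : (C.2 : ℕ).size ≤ m) (r) :
    Trans .body r (initCtx m k)
      (encUnary n ++ (((List.range n).flatMap fun i => (List.range n).flatMap fun j =>
        encOptFrac (W i j)) ++ encFrac C)) (outWord m k n W C) (fun _ => [])
      (n * (n * (m * 61 + n * 10 + 64) + 15) + n * (m * 40 + n * 24 + 74) + n * 12 + m * 23 +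
        k * 12 + 65) := by
  have hf := frame_mainCtx n m k
  refine (Trans.seq (trans_header n m k r) fun r => (hf.trans_rows ?_ ?_ W hW r).seq fun r =>
    (hf.trans_lastRow C hC hC2 r).seq fun r => (hf.trans_indices r).seq fun r =>
    (hf.trans_bound r).seq fun r => hf.trans_cleanup ?_ r).congr rfl ?_ ?_ ?_ |>.mono (by lia)
  · simp [mainCtx]
  · simp [mainCtx, initCtx]
  · simp [mainCtx]
  · simp
  · simp [outWord]
  · funext j
    cases j <;> simp [mainCtx, initCtx]

theorem run_prepare (x : List Γ') (r) :
    ∃ r', Run .prepare r (Function.update (fun _ => []) .inp x) r'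
      (io (initCtx (6 * x.length) (8 * x.length)) x []) (6 * x.length + 2) := by
  have key : ∀ (x a : List Γ') (p q : ℕ) (r), Run (.each .inp (.copy .aux ;;
      (.put .len (List.replicate 6 (Γ'.bit true)) ;; .put .thr (List.replicate 8 (Γ'.bit true))))) r
      (Function.update (Function.update (initCtx p q) .inp x) .aux a) none
      (Function.update (initCtx (6 * x.length + p) (8 * x.length + q)) .aux (x.reverse ++ a))
      (4 * x.length + 1) := by
    intro x
    induction x with
    | nil =>
      intro a p q r
      refine (Run.loop_exit (k := .inp) (p := Option.isSome) (r := r)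
        (s := Function.update (Function.update (initCtx p q) .inp []) .aux a)
        (by simp) (le_refl 1)).congr rfl ?_ ?_ (Nat.le_add_left 1 _)
      · simp
      · funext j
        cases j <;> simp [initCtx]
    | cons y x ih =>
      intro a p q r
      have h2 := ih (y :: a) (6 + p) (8 + q) (some y)
      have h1 : Run (.copy .aux ;; (.put .len (List.replicate 6 (Γ'.bit true)) ;;
          .put .thr (List.replicate 8 (Γ'.bit true)))) (some y)
          (Function.update (Function.update (initCtx p q) .inp x) .aux a) (some y)
          (Function.update (Function.update (initCtx (6 + p) (8 + q)) .inp x) .aux (y :: a)) 3 := by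
        refine (Run.seq (Run.copy (k := .aux) (r := some y) (s := Function.update
          (Function.update (initCtx p q) .inp x) .aux a) le_rfl) (Run.seq (Run.put le_rfl)
          (Run.put le_rfl) le_rfl) le_rfl).congr rfl rfl ?_ le_rfl
        funext j
        cases j <;> simp [initCtx, List.replicate_add]
      refine Run.loop_step (p := Option.isSome) (t₁ := 3) (t₂ := 4 * x.length + 1) (by simp)
        (h1.congr ?_ rfl rfl le_rfl) (h2.congr rfl rfl ?_ le_rfl)
        (by simp only [List.length_cons]; lia)
      · funext j
        cases j <;> simp [initCtx]
      · rw [List.length_cons,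
          show 6 * x.length + (6 + p) = 6 * (x.length + 1) + p by ring,
          show 8 * x.length + (8 + q) = 8 * (x.length + 1) + q by ring]
        simp
  have h1 := key x [] 0 0 r
  have h2 := run_move (k := .aux) (k' := .inp) (by decide) none
    (Function.update (initCtx (6 * x.length + 0) (8 * x.length + 0)) .aux (x.reverse ++ []))
  refine ⟨none, Run.seq (h1.congr ?_ rfl rfl le_rfl) (h2.congr rfl rfl ?_ ?_)
    (t₁ := 4 * x.length + 1) (t₂ := x.length * 2 + 1) (by omega)⟩
  · funext j
    cases j <;> simp [initCtx]
  · funext j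
    cases j <;> simp [initCtx, io]
  · simp

/-- The program turns the encoding of a weighted graph and a bound into the output word, in a number
of steps that is bounded by a polynomial in the length `x.length` of its input. -/
theorem exists_run_reduction : ∃ P : Polynomial ℕ, ∀ (n : ℕ) (W : ℕ → ℕ → Option Frac) (C : Frac)
    (x : List Γ'), x = encUnary n ++ (((List.range n).flatMap fun i => (List.range n).flatMap
      fun j => encOptFrac (W i j)) ++ encFrac C) →
    (∀ i < n, ∀ j < n, ∀ q ∈ W i j, q.1.natAbs.size ≤ x.length ∧ (q.2 : ℕ).size ≤ x.length) →
    C.1.natAbs.size ≤ x.length → (C.2 : ℕ).size ≤ x.length →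
    Run .reduction none (Function.update (fun _ => []) .inp x) none
      (Function.update (fun _ => []) .out (outWord (6 * x.length) (8 * x.length) n W C))
      (P.eval x.length) := by
  obtain ⟨B, hB⟩ := exists_growth .body
  refine ⟨Polynomial.C (1000 + 2000 * B) * (Polynomial.X + 1) ^ 3 + Polynomial.C 6 * Polynomial.X +
    Polynomial.C 3, fun n W C x hx hW hC hC2 => ?_⟩
  set L := x.length with hL
  set E := outWord (6 * L) (8 * L) n W C with hE
  have hn : n ≤ L := by
    rw [hL, hx]; simp [encUnary]
  obtain ⟨r₁, h1⟩ := run_prepare x none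
  have hbody := trans_body (n := n) (m := 6 * L) (k := 8 * L) W C
    (fun i hi j hj q hq => (hW i hi j hj q hq).imp (by omega) (by omega)) (by omega) (by omega)
  rw [← hx] at hbody
  -- Scans run over at most `8 L` symbols each and are nested at most three deep.
  have hT : n * (n * (6 * L * 61 + n * 10 + 64) + 15) + n * (6 * L * 40 + n * 24 + 74) + n * 12 +
      6 * L * 23 + 8 * L * 12 + 65 ≤ 1000 * (L + 1) ^ 3 := by
    calc _ ≤ L * (L * (6 * L * 61 + L * 10 + 64) + 15) + L * (6 * L * 40 + L * 24 + 74) + L * 12 +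
          6 * L * 23 + 8 * L * 12 + 65 := by gcongr
      _ ≤ _ := by nlinarith [Nat.zero_le (L ^ 2), Nat.zero_le (L ^ 3)]
  obtain ⟨r₂, h2⟩ := (hbody r₁).mono hT [] []
  rw [List.append_nil, List.append_nil] at h2
  have hlen : E.length ≤ 1000 * (L + 1) ^ 3 * B := by
    have := hB h2 .w
    simpa using this
  have h3 := run_move (k := .w) (k' := .out) (by decide) r₂ (io (fun _ => []) [] E.reverse)
  refine Run.seq h1 (Run.seq h2 (h3.congr rfl rfl ?_ ?_) (t₂ := E.length * 2 + 1) le_rfl) ?_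
  · funext j
    cases j <;> simp [io]
  · simp
  · simp only [Polynomial.eval_add, Polynomial.eval_mul, Polynomial.eval_pow, Polynomial.eval_X,
      Polynomial.eval_C, Polynomial.eval_one]
    nlinarith

end

/-! ### Hamiltonian paths as lists -/

/-- The values of a function on the pairs of consecutive elements of the list `a :: l`. -/
def stepValues {V R : Type*} (f : V → V → R) : V → List V → List R
  | _, [] => []
  | a, b :: l => f a b :: stepValues f b l

theorem length_stepValues {V R : Type*} (f : V → V → R) (a : V) (l : List V) :
    (stepValues f a l).length = l.length := by
  induction l generalizing a <;> simp_all [stepValues]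

theorem isChain_of_transProd_ne_zero {S K : Type*} [Field K] {T : Matrix S S K} {a : S} {l : List S}
    (h : transProd T a l ≠ 0) : (a :: l).IsChain fun i j => T i j ≠ 0 := by
  induction l generalizing a with
  | nil => simp
  | cons b l ih =>
    rw [transProd, mul_ne_zero_iff] at h
    exact List.isChain_cons_cons.2 ⟨h.1, ih h.2⟩

open scoped Classical in
/-- The weight of the edge between two vertices, and `0` if there is none. -/
def edgeWeight {V R : Type*} [Zero R] {G : SimpleGraph V} (w : G.edgeSet → R) (i j : V) : R :=
  if h : G.Adj i j then w ⟨s(i, j), h⟩ else 0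

theorem walkWeight_eq {V R : Type*} [AddCommMonoid R] {G : SimpleGraph V} (w : G.edgeSet → R)
    {u v : V} (q : G.Walk u v) :
    walkWeight w q = (stepValues (edgeWeight w) u q.support.tail).sum := by
  induction q with
  | nil => simp [walkWeight, stepValues]
  | @cons u v x h p ih =>
    have h1 : walkWeight w (.cons h p) = w ⟨s(u, v), h⟩ + walkWeight w p := by
      simp [walkWeight, List.attach_cons, Function.comp_def]
    have h2 : (SimpleGraph.Walk.cons h p).support.tail = v :: p.support.tail := by
      rw [SimpleGraph.Walk.support_cons, List.tail_cons]
      exact p.cons_tail_support.symm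
    rw [h1, h2, stepValues, List.sum_cons, ih, edgeWeight, dif_pos h]

theorem perm_univ_toList_iff {V : Type*} [Fintype V] [DecidableEq V] (l : List V) :
    l.Perm Finset.univ.toList ↔ ∀ a, l.count a = 1 := by
  rw [List.perm_iff_count]
  refine forall_congr' fun a => ?_
  rw [List.count_eq_one_of_mem (Finset.nodup_toList _) (by simp)]

/-- A Hamiltonian path is an arrangement of the vertices in which consecutive vertices are
adjacent. -/
theorem hasHamiltonianPath_iff {V R : Type*} [Fintype V] [DecidableEq V] [AddCommMonoid R] [LE R]
    {G : SimpleGraph V} (w : G.edgeSet → R) (C : R) :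
    HasHamiltonianPath w C ↔ ∃ (a : V) (l : List V), (a :: l).Perm Finset.univ.toList ∧
      (a :: l).IsChain G.Adj ∧ (stepValues (edgeWeight w) a l).sum ≤ C := by
  constructor
  · rintro ⟨u, v, q, hq, hw⟩
    refine ⟨u, q.support.tail, ?_, ?_, by rwa [← walkWeight_eq]⟩
    · rw [SimpleGraph.Walk.cons_tail_support, perm_univ_toList_iff]
      exact hq
    · rw [SimpleGraph.Walk.cons_tail_support]
      exact q.isChain_adj_support
  · rintro ⟨a, l, hp, hc, hw⟩
    refine ⟨_, _, SimpleGraph.Walk.ofSupport (a :: l) (by simp) hc, ?_, ?_⟩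
    · intro b
      rw [SimpleGraph.Walk.support_ofSupport]
      exact (perm_univ_toList_iff _).1 hp b
    · rw [walkWeight_eq, SimpleGraph.Walk.support_ofSupport]
      exact hw

/-! ### The Markov chain of a weighted graph -/

section Chain

variable {V : Type*} {G : SimpleGraph V} (w : G.edgeSet → ℝ)

theorem expWeight_of_adj {i j : V} (h : G.Adj i j) :
    expWeight w i j = Real.exp (-edgeWeight w i j) := by
  rw [expWeight, dif_pos h, edgeWeight, dif_pos h]

theorem expWeight_ne_zero_iff {i j : V} : expWeight w i j ≠ 0 ↔ G.Adj i j := by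
  by_cases h : G.Adj i j
  · simp [expWeight, h]
  · simp [expWeight, h]

theorem expWeight_nonneg (i j : V) : 0 ≤ expWeight w i j := by
  rw [expWeight]
  split_ifs
  · positivity
  · exact le_rfl

variable [Fintype V] [Nonempty V]

theorem sum_expWeight_le (i : V) : ∑ j, expWeight w i j ≤ expDelta w :=
  Finset.le_sup' (fun i => ∑ j, expWeight w i j) (Finset.mem_univ i)

theorem expDelta_nonneg : 0 ≤ expDelta w :=
  (Finset.sum_nonneg fun j _ => expWeight_nonneg w (Classical.arbitrary V) j).trans
    (sum_expWeight_le w _)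

theorem expDelta_pos (h : G ≠ ⊥) : 0 < expDelta w := by
  obtain ⟨i, j, hij⟩ := SimpleGraph.ne_bot_iff_exists_adj.1 h
  refine lt_of_lt_of_le ?_ (sum_expWeight_le w i)
  refine lt_of_lt_of_le ?_
    (Finset.single_le_sum (fun k _ => expWeight_nonneg w i k) (Finset.mem_univ j))
  exact lt_of_le_of_ne (expWeight_nonneg w i j) ((expWeight_ne_zero_iff w).2 hij).symm

variable [DecidableEq V]

theorem expChain_of_ne {i j : V} (h : i ≠ j) : expChain w i j = expWeight w i j / expDelta w := by
  simp [expChain, h]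

theorem expChain_self (i : V) :
    expChain w i i = 1 - ∑ k ∈ Finset.univ.erase i, expWeight w i k / expDelta w := by
  simp [expChain]

theorem expChain_mem_rowStochastic : expChain w ∈ Matrix.rowStochastic ℝ V := by
  rw [Matrix.mem_rowStochastic_iff_sum]
  constructor
  · intro i j
    by_cases h : i = j
    · subst h
      rw [expChain_self, sub_nonneg, ← Finset.sum_div]
      refine div_le_one_of_le₀ (le_trans ?_ (sum_expWeight_le w i)) (expDelta_nonneg w)
      exact Finset.sum_le_sum_of_subset_of_nonneg (Finset.erase_subset _ _)
        fun k _ _ => expWeight_nonneg w i k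
    · rw [expChain_of_ne w h]
      exact div_nonneg (expWeight_nonneg w i j) (expDelta_nonneg w)
  · intro i
    rw [← Finset.add_sum_erase _ _ (Finset.mem_univ i), expChain_self]
    have : ∑ k ∈ Finset.univ.erase i, expChain w i k =
        ∑ k ∈ Finset.univ.erase i, expWeight w i k / expDelta w :=
      Finset.sum_congr rfl fun k hk => expChain_of_ne w (Finset.ne_of_mem_erase hk).symm
    rw [this, sub_add_cancel]

theorem transProd_expChain {a : V} {l : List V} (h : (a :: l).IsChain G.Adj) :
    transProd (expChain w) a l =
      Real.exp (-(stepValues (edgeWeight w) a l).sum) / expDelta w ^ l.length := by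
  induction l generalizing a with
  | nil => simp [transProd, stepValues]
  | cons b l ih =>
    rw [List.isChain_cons_cons] at h
    rw [transProd, ih h.2, expChain_of_ne w h.1.ne, expWeight_of_adj w h.1, stepValues,
      List.sum_cons, neg_add, Real.exp_add, List.length_cons, pow_succ, div_mul_div_comm,
      mul_comm (expDelta w)]

theorem isChain_adj_of_transProd_ne_zero {a : V} {l : List V} (hnd : (a :: l).Nodup)
    (h : transProd (expChain w) a l ≠ 0) : (a :: l).IsChain G.Adj := by
  induction l generalizing a with
  | nil => simp
  | cons b l ih =>
    rw [transProd, mul_ne_zero_iff] at h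
    have hab : a ≠ b := by rintro rfl; simp at hnd
    have h1 := h.1
    rw [expChain_of_ne w hab, div_ne_zero_iff] at h1
    exact List.isChain_cons_cons.2
      ⟨(expWeight_ne_zero_iff w).1 h1.1, ih (List.nodup_cons.1 hnd).2 h.2⟩

/-- An order of the vertices has positive probability only if it is a Hamiltonian path, and then
its probability determines its weight. -/
theorem hasHamiltonianPath_iff_hasOrder (C : ℝ) (hG : 1 < Fintype.card V → G ≠ ⊥) :
    HasHamiltonianPath w C ↔
      HasOrder (expChain w) Finset.univ.toList (expThreshold w C) := by
  have hcard : (0 : ℝ) < Fintype.card V := by exact_mod_cast Fintype.card_pos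
  have hpow : 0 < expDelta w ^ (Fintype.card V - 1) := by
    rcases Nat.lt_or_ge 1 (Fintype.card V) with h | h
    · exact pow_pos (expDelta_pos w (hG h)) _
    · rw [Nat.sub_eq_zero_of_le h, pow_zero]; exact one_pos
  have key : ∀ (a : V) (l : List V), (a :: l).Perm Finset.univ.toList → (a :: l).IsChain G.Adj →
      (expThreshold w C ≤ genProb (expChain w) (a :: l) ↔
        (stepValues (edgeWeight w) a l).sum ≤ C) := by
    intro a l hp hc
    have hlen : l.length = Fintype.card V - 1 := by
      have := hp.length_eq
      simp at this
      omega
    rw [genProb, transProd_expChain w hc, hlen, expThreshold, ← div_eq_inv_mul, div_div,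
      mul_comm (expDelta w ^ _), div_le_div_iff_of_pos_right (by positivity), Real.exp_le_exp,
      neg_le_neg_iff]
  rw [hasHamiltonianPath_iff]
  constructor
  · rintro ⟨a, l, hp, hc, hw⟩
    exact ⟨a :: l, hp, (key a l hp hc).2 hw⟩
  · rintro ⟨Y, hp, hY⟩
    cases Y with
    | nil =>
      have := hp.length_eq
      simp only [List.length_nil, Finset.length_toList, Finset.card_univ] at this
      exact absurd this Fintype.card_pos.ne
    | cons a l =>
      have hnd : (a :: l).Nodup := hp.nodup_iff.2 (Finset.nodup_toList _)
      have hc : (a :: l).IsChain G.Adj := by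
        refine isChain_adj_of_transProd_ne_zero w hnd fun h0 => ?_
        rw [genProb, h0, mul_zero, expThreshold] at hY
        have : 0 < Real.exp (-C) / (Fintype.card V * expDelta w ^ (Fintype.card V - 1)) := by
          positivity
        linarith
      exact ⟨a, l, hp, hc, (key a l hp hc).1 hY⟩

end Chain

/-! ### From sums of weights to products of probabilities -/

/-- A rational function that is approximately `1 - w / (2 M)` for large `M`. -/
def factor (M w : ℚ) : ℚ := 1 - w / (2 * M + |w|)

/-- The product of the factors agrees with `1 - (sum of the weights) / (2 M)` up to terms of second
order. -/
theorem abs_prod_factor_sub_le {M h : ℚ} (hM : 0 < M) (ws : List ℚ)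
    (hw : ∀ w ∈ ws, |w| / (2 * M) ≤ h) (hh : ws.length * h ≤ 1) :
    |(ws.map (factor M)).prod - 1 + ws.sum / (2 * M)| ≤ (ws.length * h) ^ 2 ∧
      |ws.sum / (2 * M)| ≤ ws.length * h := by
  induction ws with
  | nil => simp
  | cons w ws ih =>
    have hw0 := hw w (by simp)
    have h0 : 0 ≤ h := le_trans (by positivity) hw0
    simp only [List.length_cons, Nat.cast_add, Nat.cast_one] at hh ⊢
    obtain ⟨h1, h2⟩ := ih (fun x hx => hw x (by simp [hx])) (by nlinarith)
    set K := (ws.length : ℚ) with hK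
    have hK0 : 0 ≤ K := by positivity
    set P := (ws.map (factor M)).prod
    set S := ws.sum / (2 * M) with hS
    set x := w / (2 * M) with hx
    set f := factor M w with hf
    have hxh : |x| ≤ h := by
      rw [hx, abs_div, abs_of_pos (show 0 < 2 * M by positivity)]; exact hw0
    have hd : 0 < 2 * M + |w| := by positivity
    have hf1 : |f - 1| ≤ h := by
      rw [hf, factor, sub_sub_cancel_left, abs_neg, abs_div, abs_of_pos hd]
      refine le_trans ?_ hw0
      gcongr
      linarith [abs_nonneg w]
    have hf2 : |f - 1 + x| ≤ h ^ 2 := by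
      have e : f - 1 + x = (w / (2 * M + |w|)) * (|w| / (2 * M)) := by
        rw [hf, factor, hx]
        field_simp
        ring
      have e2 : |w / (2 * M + |w|)| ≤ h := by
        have : f - 1 = -(w / (2 * M + |w|)) := by rw [hf, factor]; ring
        rwa [this, abs_neg] at hf1
      rw [e, abs_mul, abs_of_nonneg (show 0 ≤ |w| / (2 * M) by positivity), sq]
      exact mul_le_mul e2 hw0 (by positivity) h0
    have hP : |P - 1| ≤ 2 * (K * h) := by
      have e : P - 1 = (P - 1 + S) - S := by ring
      rw [e]
      refine (abs_sub _ _).trans ?_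
      have : (K * h) ^ 2 ≤ K * h := by
        have : 0 ≤ K * h := by positivity
        nlinarith
      linarith
    constructor
    · have e : ((w :: ws).map (factor M)).prod - 1 + (w :: ws).sum / (2 * M) =
          (P - 1 + S) + (P - 1) * (f - 1) + (f - 1 + x) := by
        rw [List.map_cons, List.prod_cons, List.sum_cons, add_div]
        ring
      rw [e]
      refine (abs_add_three _ _ _).trans ?_
      rw [abs_mul]
      have : |P - 1| * |f - 1| ≤ 2 * (K * h) * h := mul_le_mul hP hf1 (abs_nonneg _) (by positivity)
      nlinarith
    · rw [List.sum_cons, add_div]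
      refine (abs_add_le _ _).trans ?_
      linarith

/-- If the weights have a small common denominator and small absolute values, the sign of
their sum is determined by the product of the factors. -/
theorem le_prod_factor_iff {H : ℚ} (hH : 4 ≤ H) (ws : List ℚ) (hlen : (ws.length : ℚ) ≤ H)
    (hw : ∀ w ∈ ws, |w| ≤ H) {P : ℕ} (hP : 0 < P) (hPH : (P : ℚ) ≤ H)
    (hint : ∀ w ∈ ws, ∃ z : ℤ, P * w = z) :
    1 - 1 / H ^ 8 ≤ (ws.map (factor (H ^ 6))).prod ↔ ws.sum ≤ 0 := by
  have hH0 : 0 < H := by linarith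
  have hK : (ws.length : ℚ) * (H / (2 * H ^ 6)) ≤ H * (H / (2 * H ^ 6)) := by gcongr
  have hE : H * (H / (2 * H ^ 6)) = 1 / (2 * H ^ 4) := by field_simp
  have hE1 : 1 / (2 * H ^ 4) ≤ 1 := by
    rw [div_le_one (by positivity)]
    have : 1 ≤ H ^ 4 := one_le_pow₀ (by linarith)
    linarith
  obtain ⟨h1, -⟩ := abs_prod_factor_sub_le (M := H ^ 6) (h := H / (2 * H ^ 6)) (by positivity) ws
    (fun w h => by gcongr; exact hw w h) (by linarith)
  have h2 : ((ws.length : ℚ) * (H / (2 * H ^ 6))) ^ 2 ≤ 1 / 4 * (1 / H ^ 8) := by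
    calc _ ≤ (1 / (2 * H ^ 4)) ^ 2 := by
          rw [← hE]; gcongr
      _ = _ := by field_simp; norm_num
  have h3 := abs_le.1 (h1.trans h2)
  have h8 : 0 < 1 / H ^ 8 := by positivity
  constructor
  · intro h
    by_contra! hpos
    -- A positive sum is at least `1 / P`, because `P` is a common denominator.
    have hz : ∃ z : ℤ, P * ws.sum = z := by
      clear * - hint
      induction ws with
      | nil => exact ⟨0, by simp⟩
      | cons w ws ih =>
        obtain ⟨z, hz⟩ := ih fun x hx => hint x (by simp [hx])
        obtain ⟨y, hy⟩ := hint w (by simp)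
        exact ⟨y + z, by rw [List.sum_cons, mul_add, hz, hy]; push_cast; ring⟩
    obtain ⟨z, hz⟩ := hz
    have hPq : (0 : ℚ) < P := by exact_mod_cast hP
    have hz1 : (1 : ℚ) ≤ P * ws.sum := by
      have : (0 : ℚ) < z := by rw [← hz]; positivity
      rw [hz]
      exact_mod_cast Int.add_one_le_of_lt (by exact_mod_cast this : (0 : ℤ) < z)
    have hs : 1 ≤ H * ws.sum := hz1.trans (by gcongr)
    -- The linear term `1 / (2 H ^ 7)` exceeds the gap `1 / H ^ 8` and the error `1 / (4 H ^ 8)`.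
    have h5 : H * (1 / H ^ 8) / 2 ≤ ws.sum / (2 * H ^ 6) := by
      rw [le_div_iff₀ (by positivity)]
      have : H * (1 / H ^ 8) / 2 * (2 * H ^ 6) = 1 / H := by field_simp
      rw [this, div_le_iff₀ hH0]
      linarith
    nlinarith
  · intro h
    have h5 : ws.sum / (2 * H ^ 6) ≤ 0 := div_nonpos_of_nonpos_of_nonneg h (by positivity)
    linarith

/-! ### The values of the transition probabilities -/

theorem val_zeroFrac : zeroFrac.val = 0 := by simp [zeroFrac, Frac.val]

theorem val_dyadic (j : ℕ) : (dyadic j).val = 1 / 2 ^ j := by simp [dyadic, Frac.val]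

theorem val_edgeLow (m j a : ℕ) (b : ℕ+) :
    (edgeLow m j a b).val = 2 ^ m * (b : ℕ) / (2 ^ j * (2 ^ (m + 1) * (b : ℕ) + a)) := by
  simp [edgeLow, edgeDen, Frac.val]

theorem val_edgeHigh (m j a : ℕ) (b : ℕ+) :
    (edgeHigh m j a b).val = (2 ^ m * (b : ℕ) + a) / (2 ^ j * (2 ^ (m + 1) * (b : ℕ) + a)) := by
  simp [edgeHigh, edgeDen, Frac.val]

theorem abs_val (q : Frac) : |q.val| = (q.1.natAbs : ℚ) / (q.2 : ℕ) := by
  rw [Frac.val, abs_div, Nat.abs_cast, Nat.cast_natAbs, Int.cast_abs]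

/-- The probability of an edge is a fixed multiple of the factor for both signs of the weight,
although the machine never subtracts. -/
theorem val_cellMass_some (m j : ℕ) (q : Frac) :
    (cellMass m j (some q)).1.val = 1 / 2 ^ (j + 1) * factor (2 ^ m) q.val := by
  have hb : (0 : ℚ) < (q.2 : ℕ) := by exact_mod_cast q.2.pos
  have ha : (0 : ℚ) ≤ q.1.natAbs := by positivity
  have hq : q.val = (q.1 : ℚ) / (q.2 : ℕ) := rfl
  rw [factor, abs_val, hq, cellMass, edgeMass]
  by_cases h : q.1 < 0
  · have h1 : (q.1 : ℚ) = -(q.1.natAbs : ℚ) := by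
      rw [Nat.cast_natAbs, Int.cast_abs, abs_of_neg (by exact_mod_cast h), neg_neg]
    rw [h1]
    simp only [h, decide_true, cond_true, val_edgeHigh]
    field_simp
    ring
  · have h1 : (q.1 : ℚ) = (q.1.natAbs : ℚ) := by
      rw [Nat.cast_natAbs, Int.cast_abs, abs_of_nonneg (by exact_mod_cast not_lt.1 h)]
    rw [h1]
    simp only [h, decide_false, cond_false, val_edgeLow]
    field_simp
    ring

theorem val_nonneg_edgeLow (m j a : ℕ) (b : ℕ+) : 0 ≤ (edgeLow m j a b).val := by
  rw [val_edgeLow]; positivity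

theorem val_nonneg_edgeHigh (m j a : ℕ) (b : ℕ+) : 0 ≤ (edgeHigh m j a b).val := by
  rw [val_edgeHigh]; positivity

theorem val_nonneg_cellMass (m j : ℕ) (o : Option Frac) :
    0 ≤ (cellMass m j o).1.val ∧ 0 ≤ (cellMass m j o).2.val := by
  cases o with
  | none => simp [cellMass, val_zeroFrac, val_dyadic]
  | some q =>
    by_cases h : q.1 < 0 <;>
      simp [cellMass, edgeMass, h, val_nonneg_edgeLow, val_nonneg_edgeHigh]

theorem val_cellMass_add (m j : ℕ) (o : Option Frac) :
    (cellMass m j o).1.val + (cellMass m j o).2.val = 1 / 2 ^ j := by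
  cases o with
  | none => simp [cellMass, val_zeroFrac, val_dyadic]
  | some q =>
    have key : (edgeLow m j q.1.natAbs q.2).val + (edgeHigh m j q.1.natAbs q.2).val = 1 / 2 ^ j := by
      have hb : (0 : ℚ) < (q.2 : ℕ) := by exact_mod_cast q.2.pos
      have ha : (0 : ℚ) ≤ q.1.natAbs := by positivity
      rw [val_edgeLow, val_edgeHigh]
      field_simp
      ring
    by_cases h : q.1 < 0
    · rw [← key, add_comm (edgeLow m j q.1.natAbs q.2).val]
      simp [cellMass, edgeMass, h]
    · rw [← key]
      simp [cellMass, edgeMass, h]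

/-! ### The transition matrix of the reduction -/

/-- The transition probabilities, for `n` vertices and the rows `0, …, n` of weights `W`, where row
`n` is that of the additional vertex. State `2 i` is vertex `i`, and state `2 i + 1` stands for
having gone astray. -/
def orderT (m n : ℕ) (W : ℕ → ℕ → Option Frac) (x y : ℕ) : Frac :=
  if x % 2 = 0 then
    if y < 2 * n then
      if y % 2 = 0 then (cellMass m (y / 2 + 1) (W (x / 2) (y / 2))).1
      else (cellMass m (y / 2 + 1) (W (x / 2) (y / 2))).2
    else if y = 2 * n then zeroFrac else dyadic n
  else if y = 0 then dyadic 0 else zeroFrac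

section

variable (m n : ℕ) (W : ℕ → ℕ → Option Frac)

theorem orderT_even_even (i : ℕ) {j : ℕ} (hj : j < n) :
    orderT m n W (2 * i) (2 * j) = (cellMass m (j + 1) (W i j)).1 := by
  simp [orderT, hj]

theorem orderT_even_odd (i : ℕ) {j : ℕ} (hj : j < n) :
    orderT m n W (2 * i) (2 * j + 1) = (cellMass m (j + 1) (W i j)).2 := by
  have h1 : 2 * j + 1 < 2 * n := by omega
  have h2 : (2 * j + 1) / 2 = j := by omega
  have h3 : (2 * j + 1) % 2 = 1 := by omega
  simp [orderT, h1, h2, h3]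

theorem orderT_even_two_mul (i : ℕ) : orderT m n W (2 * i) (2 * n) = zeroFrac := by simp [orderT]

theorem orderT_even_last (i : ℕ) : orderT m n W (2 * i) (2 * n + 1) = dyadic n := by
  simp [orderT]

theorem orderT_odd (i y : ℕ) :
    orderT m n W (2 * i + 1) y = if y = 0 then dyadic 0 else zeroFrac := by
  have h3 : (2 * i + 1) % 2 = 1 := by omega
  simp [orderT, h3]

theorem val_nonneg_orderT (x y : ℕ) : 0 ≤ (orderT m n W x y).val := by
  rw [orderT]
  split_ifs <;> simp [val_zeroFrac, val_dyadic, val_nonneg_cellMass]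

theorem sum_range_two_mul {M : Type*} [AddCommMonoid M] (f : ℕ → M) (k : ℕ) :
    ∑ y ∈ Finset.range (2 * k), f y = ∑ j ∈ Finset.range k, (f (2 * j) + f (2 * j + 1)) := by
  induction k with
  | zero => simp
  | succ k ih =>
    rw [show 2 * (k + 1) = 2 * k + 1 + 1 by ring, Finset.sum_range_succ, Finset.sum_range_succ,
      Finset.sum_range_succ, ih, add_assoc]

theorem sum_orderT (x : ℕ) :
    ∑ y ∈ Finset.range (2 * (n + 1)), (orderT m n W x y).val = 1 := by
  rw [sum_range_two_mul, Finset.sum_range_succ]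
  rcases Nat.even_or_odd' x with ⟨i, rfl | rfl⟩
  · have h1 : ∀ j ∈ Finset.range n, (orderT m n W (2 * i) (2 * j)).val +
        (orderT m n W (2 * i) (2 * j + 1)).val = 1 / 2 ^ (j + 1) := by
      intro j hj
      rw [orderT_even_even m n W i (Finset.mem_range.1 hj),
        orderT_even_odd m n W i (Finset.mem_range.1 hj), val_cellMass_add]
    have h2 : ∀ n : ℕ, ∑ j ∈ Finset.range n, 1 / (2 : ℚ) ^ (j + 1) = 1 - 1 / 2 ^ n := by
      intro n
      induction n with
      | zero => simp
      | succ n ih => rw [Finset.sum_range_succ, ih]; field_simp; ring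
    rw [Finset.sum_congr rfl h1, h2, orderT_even_two_mul, orderT_even_last, val_zeroFrac,
      val_dyadic]
    ring
  · simp only [orderT_odd]
    cases n with
    | zero => simp [val_dyadic, val_zeroFrac]
    | succ n => simp [Finset.sum_range_succ', val_dyadic, val_zeroFrac]

theorem flatMap_range_two_mul {α : Type*} (f : ℕ → List α) (k : ℕ) :
    (List.range (2 * k)).flatMap f = (List.range k).flatMap fun j => f (2 * j) ++ f (2 * j + 1) := by
  induction k with
  | zero => simp
  | succ k ih =>
    rw [show 2 * (k + 1) = 2 * k + 1 + 1 by ring, List.range_succ, List.range_succ,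
      List.range_succ, List.flatMap_append, List.flatMap_append, List.flatMap_append, ih]
    simp

theorem append_flatten_replicate {α : Type*} (z : List α) (n : ℕ) :
    z ++ (List.replicate n (z ++ z)).flatten = (List.replicate n (z ++ z)).flatten ++ z := by
  induction n with
  | zero => simp
  | succ n ih =>
    simp only [List.replicate_succ, List.flatten_cons, List.append_assoc]
    rw [ih]

theorem flatMap_orderT (i : ℕ) :
    ((List.range (2 * (n + 1))).flatMap fun y => encFrac (orderT m n W (2 * i) y)) ++
      ((List.range (2 * (n + 1))).flatMap fun y => encFrac (orderT m n W (2 * i + 1) y)) =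
      rowsWord m n (W i) := by
  rw [flatMap_range_two_mul, flatMap_range_two_mul, rowsWord]
  have h1 : (List.range n).flatMap (fun j => encFrac (orderT m n W (2 * i) (2 * j)) ++
      encFrac (orderT m n W (2 * i) (2 * j + 1))) =
      (List.range n).flatMap fun j => encPair (cellMass m (j + 1) (W i j)) := by
    refine List.flatMap_congr fun j hj => ?_
    rw [orderT_even_even m n W i (List.mem_range.1 hj),
      orderT_even_odd m n W i (List.mem_range.1 hj), encPair]
  have h2 : (List.range (n + 1)).flatMap (fun j => encFrac (orderT m n W (2 * i + 1) (2 * j)) ++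
      encFrac (orderT m n W (2 * i + 1) (2 * j + 1))) = sinkWord n := by
    simp only [orderT_odd, List.range_succ_eq_map, List.flatMap_cons, List.flatMap_map, sinkWord,
      ← append_flatten_replicate]
    simp [List.flatMap, List.map_const']
  rw [h2, List.range_succ, List.flatMap_append, h1, rowEndWord]
  simp [orderT_even_two_mul, orderT_even_last]

end

theorem encVec_eq_flatMap {α : Type} {e : α → List Γ'} {n : ℕ} {f : Fin n → α}
    {g : ℕ → List Γ'} (h : ∀ i, e (f i) = g i) : encVec e f = (List.range n).flatMap g := by
  rw [encVec, ← List.map_coe_finRange_eq_range, List.flatMap_map]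
  exact List.flatMap_congr fun i _ => h i

theorem encIndices_eq_flatMap {n : ℕ} (l : List (Fin n)) :
    encIndices l = (l.map Fin.val).flatMap (fun i => Γ'.comma :: encUnary i) ++ [Γ'.ket] := by
  induction l with
  | nil => rfl
  | cons i l ih => simp [encIndices, ih]

/-! ### The instance of the ordering problem -/

/-- The length of the encoding of an instance. -/
def TSPPInstance.size (I : TSPPInstance) : ℕ := I.encode.length

/-- The rows of weights: the weighted adjacency matrix, and minus the bound for the edges of the
additional vertex. -/
def TSPPInstance.weights (I : TSPPInstance) (i j : ℕ) : Option Frac :=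
  if i < I.n then
    if h : i < I.n ∧ j < I.n then weightMatrix I.G I.w ⟨i, h.1⟩ ⟨j, h.2⟩ else none
  else some (-I.C.1, I.C.2)

theorem TSPPInstance.weights_coe (I : TSPPInstance) (i j : Fin I.n) :
    I.weights i j = weightMatrix I.G I.w i j := by
  simp [TSPPInstance.weights]

theorem TSPPInstance.weights_n (I : TSPPInstance) :
    I.weights I.n = fun _ => some (-I.C.1, I.C.2) := by
  funext j
  simp [TSPPInstance.weights]

/-- The state of a vertex. -/
def vertexState {n : ℕ} (v : Fin n) : Fin (2 * (n + 1)) := ⟨2 * v, by omega⟩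

/-- The transition matrix of the reduction. -/
def TSPPInstance.matrix (I : TSPPInstance) (x y : Fin (2 * (I.n + 1))) : Frac :=
  orderT (6 * I.size) I.n I.weights x y

/-- The state of the additional vertex. -/
def startState (n : ℕ) : Fin (2 * (n + 1)) := ⟨2 * n, by omega⟩

/-- The instance of the ordering problem to which an instance of the path problem is mapped. -/
def TSPPInstance.toOrder (I : TSPPInstance) : OrderInstance where
  n := 2 * (I.n + 1)
  n_pos := by omega
  T := I.matrix
  stochastic := by
    rw [Matrix.mem_rowStochastic_iff_sum]
    refine ⟨fun x y => val_nonneg_orderT _ _ _ _ _, fun x => ?_⟩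
    rw [← sum_orderT (6 * I.size) I.n I.weights x, ← Fin.sum_univ_eq_sum_range
      (fun y => (orderT (6 * I.size) I.n I.weights x y).val)]
    rfl
  X := (List.finRange I.n).map vertexState ++ [startState I.n]
  p := threshold I.n (8 * I.size)

theorem TSPPInstance.encode_toOrder (I : TSPPInstance) :
    I.toOrder.encode = outWord (6 * I.size) (8 * I.size) I.n I.weights I.C := by
  have h1 : encMat encFrac I.matrix = ((List.range I.n).flatMap fun i =>
      rowsWord (6 * I.size) I.n (I.weights i)) ++
      rowsWord (6 * I.size) I.n fun _ => some (-I.C.1, I.C.2) := by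
    have h0 : encMat encFrac I.matrix = (List.range (2 * (I.n + 1))).flatMap fun x =>
        (List.range (2 * (I.n + 1))).flatMap fun y =>
          encFrac (orderT (6 * I.size) I.n I.weights x y) :=
      encVec_eq_flatMap fun i => encVec_eq_flatMap fun j => rfl
    rw [h0, flatMap_range_two_mul, List.range_succ, List.flatMap_append]
    simp only [flatMap_orderT]
    simp [I.weights_n]
  have h2 : encIndices ((List.finRange I.n).map vertexState ++ [startState I.n]) =
      indicesWord I.n := by
    rw [encIndices_eq_flatMap, indicesWord, List.range_succ, List.flatMap_append, List.map_append,
      List.flatMap_append, ← List.map_coe_finRange_eq_range, List.map_map, List.flatMap_map,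
      List.flatMap_map, List.flatMap_map]
    rfl
  change encUnary (2 * (I.n + 1)) ++ (encMat encFrac I.matrix ++
    (encIndices ((List.finRange I.n).map vertexState ++ [startState I.n]) ++
      encFrac (threshold I.n (8 * I.size)))) = _
  rw [h1, h2, outWord]
  simp

theorem TSPPInstance.encode_eq (I : TSPPInstance) :
    I.encode = encUnary I.n ++ (((List.range I.n).flatMap fun i => (List.range I.n).flatMap
      fun j => encOptFrac (I.weights i j)) ++ encFrac I.C) := by
  have h : encMat encOptFrac (weightMatrix I.G I.w) = (List.range I.n).flatMap fun i =>
      (List.range I.n).flatMap fun j => encOptFrac (I.weights i j) :=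
    encVec_eq_flatMap fun i => encVec_eq_flatMap fun j => by rw [I.weights_coe]
  rw [TSPPInstance.encode, h]

/-! ### Bounds from the length of the encoding -/

theorem length_encFrac (q : Frac) :
    (encFrac q).length = q.1.natAbs.size + (q.2 : ℕ).size + 3 := by
  simp [encFrac, encNat_eq, length_bitWord]
  omega

/-- The denominator of an entry of the weight matrix. -/
def optDen : Option Frac → ℕ
  | none => 1
  | some q => (q.2 : ℕ)

theorem optDen_pos (o : Option Frac) : 0 < optDen o := by
  cases o with
  | none => exact one_pos
  | some q => exact q.2.pos

theorem optDen_le (o : Option Frac) : optDen o ≤ 2 ^ (encOptFrac o).length := by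
  cases o with
  | none => simp [optDen, encOptFrac]
  | some q =>
    refine (Nat.lt_size_self (q.2 : ℕ)).le.trans (Nat.pow_le_pow_right two_pos ?_)
    rw [encOptFrac, length_encFrac]
    omega

theorem length_encVec {α : Type} (e : α → List Γ') {n : ℕ} (f : Fin n → α) :
    (encVec e f).length = ∑ i, (e (f i)).length := by
  rw [encVec, List.length_flatMap, Fin.sum_univ_def]

theorem TSPPInstance.size_eq (I : TSPPInstance) : I.size = I.n + 1 +
    ((∑ i, ∑ j, (encOptFrac (weightMatrix I.G I.w i j)).length) + (encFrac I.C).length) := by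
  rw [TSPPInstance.size, TSPPInstance.encode, List.length_append, List.length_append, encMat,
    length_encVec]
  simp [length_encVec, encUnary]

theorem TSPPInstance.length_weight_le (I : TSPPInstance) (i j : Fin I.n) :
    (encOptFrac (weightMatrix I.G I.w i j)).length ≤ I.size := by
  rw [I.size_eq]
  have h1 := Finset.single_le_sum (f := fun j => (encOptFrac (weightMatrix I.G I.w i j)).length)
    (fun _ _ => Nat.zero_le _) (Finset.mem_univ j)
  have h2 := Finset.single_le_sum
    (f := fun i => ∑ j, (encOptFrac (weightMatrix I.G I.w i j)).length)
    (fun _ _ => Nat.zero_le _) (Finset.mem_univ i)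
  omega

/-- A common denominator of all weights and the bound. -/
def TSPPInstance.commonDen (I : TSPPInstance) : ℕ :=
  (∏ i, ∏ j, optDen (weightMatrix I.G I.w i j)) * (I.C.2 : ℕ)

theorem TSPPInstance.commonDen_pos (I : TSPPInstance) : 0 < I.commonDen :=
  Nat.mul_pos (Finset.prod_pos fun _ _ => Finset.prod_pos fun _ _ => optDen_pos _) I.C.2.pos

theorem TSPPInstance.commonDen_le (I : TSPPInstance) : I.commonDen ≤ 2 ^ I.size := by
  have h1 : ∏ i, ∏ j, optDen (weightMatrix I.G I.w i j) ≤
      2 ^ ∑ i, ∑ j, (encOptFrac (weightMatrix I.G I.w i j)).length := by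
    simp only [← Finset.prod_pow_eq_pow_sum]
    exact Finset.prod_le_prod' fun i _ => Finset.prod_le_prod' fun j _ => optDen_le _
  have h2 : (I.C.2 : ℕ) ≤ 2 ^ (encFrac I.C).length := optDen_le (some I.C)
  calc I.commonDen ≤ _ := Nat.mul_le_mul h1 h2
    _ ≤ 2 ^ I.size := by
      rw [← pow_add, I.size_eq]
      exact Nat.pow_le_pow_right two_pos (by omega)

theorem exists_int_of_dvd {q : Frac} {P : ℕ} (h : (q.2 : ℕ) ∣ P) : ∃ z : ℤ, P * q.val = z := by
  obtain ⟨c, rfl⟩ := h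
  have hb : ((q.2 : ℕ) : ℚ) ≠ 0 := by exact_mod_cast q.2.pos.ne'
  refine ⟨c * q.1, ?_⟩
  rw [Frac.val]
  push_cast
  field_simp

theorem abs_val_le {q : Frac} {L : ℕ} (h : q.1.natAbs.size ≤ L) : |q.val| ≤ 2 ^ L := by
  have hb : (1 : ℚ) ≤ (q.2 : ℕ) := by exact_mod_cast q.2.pos
  rw [abs_val]
  refine (div_le_self (by positivity) hb).trans ?_
  exact_mod_cast (Nat.size_le.1 h).le

theorem TSPPInstance.edgeWeight_of_adj (I : TSPPInstance) {i j : Fin I.n} (h : I.G.Adj i j) :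
    edgeWeight (fun e => (I.w e).val) i j = (I.w ⟨s(i, j), h⟩).val := by
  rw [edgeWeight, dif_pos h]

/-- The weights of a path, together with minus the bound, have small absolute values and small
common denominators. -/
theorem TSPPInstance.weight_bounds (I : TSPPInstance) {a : Fin I.n} {l : List (Fin I.n)}
    (hc : (a :: l).IsChain I.G.Adj) :
    ∀ x ∈ -I.C.val :: stepValues (edgeWeight fun e => (I.w e).val) a l,
      |x| ≤ 2 ^ I.size ∧ ∃ z : ℤ, I.commonDen * x = z := by
  have h0 : ∀ {i j : Fin I.n}, I.G.Adj i j →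
      |edgeWeight (fun e => (I.w e).val) i j| ≤ 2 ^ I.size ∧
        ∃ z : ℤ, I.commonDen * edgeWeight (fun e => (I.w e).val) i j = z := by
    intro i j h
    have hw : weightMatrix I.G I.w i j = some (I.w ⟨s(i, j), h⟩) := by simp [weightMatrix, h]
    rw [I.edgeWeight_of_adj h]
    refine ⟨abs_val_le ?_, exists_int_of_dvd ?_⟩
    · have := I.length_weight_le i j
      rw [hw, encOptFrac, length_encFrac] at this
      omega
    · have h1 := Finset.dvd_prod_of_mem (fun j => optDen (weightMatrix I.G I.w i j))
        (Finset.mem_univ j)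
      have h2 := Finset.dvd_prod_of_mem (fun i => ∏ j, optDen (weightMatrix I.G I.w i j))
        (Finset.mem_univ i)
      simp only [hw] at h1
      exact (h1.trans h2).trans (Dvd.intro _ rfl)
  intro x hx
  rcases List.mem_cons.1 hx with rfl | hx
  · rw [abs_neg, mul_neg]
    constructor
    · refine abs_val_le ?_
      rw [I.size_eq, length_encFrac]
      omega
    · obtain ⟨z, hz⟩ := exists_int_of_dvd (q := I.C) (P := I.commonDen) (Dvd.intro_left _ rfl)
      exact ⟨-z, by rw [hz]; push_cast; rfl⟩
  · induction l generalizing a with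
    | nil => simp [stepValues] at hx
    | cons b l ih =>
      rw [List.isChain_cons_cons] at hc
      rw [stepValues, List.mem_cons] at hx
      rcases hx with rfl | hx
      · exact h0 hc.1
      · exact ih hc.2 (by simp [hx]) hx

/-! ### Correctness of the reduction -/

section

variable (I : TSPPInstance)

/-- The transition matrix of the reduction, with rational entries. -/
abbrev TSPPInstance.chain : Matrix (Fin (2 * (I.n + 1))) (Fin (2 * (I.n + 1))) ℚ :=
  Matrix.of fun x y => (I.matrix x y).val

theorem TSPPInstance.chain_of_adj {i j : Fin I.n} (h : I.G.Adj i j) :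
    I.chain (vertexState i) (vertexState j) = 1 / 2 ^ ((j : ℕ) + 2) *
      factor (2 ^ (6 * I.size)) (edgeWeight (fun e => (I.w e).val) i j) := by
  have hw : weightMatrix I.G I.w i j = some (I.w ⟨s(i, j), h⟩) := by simp [weightMatrix, h]
  rw [I.edgeWeight_of_adj h, ← val_cellMass_some, ← hw, ← I.weights_coe,
    ← orderT_even_even _ _ _ _ j.2]
  rfl

theorem TSPPInstance.chain_of_not_adj {i j : Fin I.n} (h : ¬ I.G.Adj i j) :
    I.chain (vertexState i) (vertexState j) = 0 := by
  have hw : weightMatrix I.G I.w i j = none := by simp [weightMatrix, h]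
  have h1 : I.chain (vertexState i) (vertexState j) =
      (orderT (6 * I.size) I.n I.weights (2 * i) (2 * j)).val := rfl
  rw [h1, orderT_even_even _ _ _ _ j.2, I.weights_coe, hw, cellMass, val_zeroFrac]

theorem TSPPInstance.chain_start (j : Fin I.n) :
    I.chain (startState I.n) (vertexState j) = 1 / 2 ^ ((j : ℕ) + 2) *
      factor (2 ^ (6 * I.size)) (-I.C.val) := by
  have h1 : I.chain (startState I.n) (vertexState j) =
      (orderT (6 * I.size) I.n I.weights (2 * I.n) (2 * j)).val := rfl
  have h2 : -I.C.val = Frac.val (-I.C.1, I.C.2) := by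
    simp only [Frac.val]; push_cast; ring
  rw [h1, orderT_even_even _ _ _ _ j.2, I.weights_n, val_cellMass_some, h2]

/-- No transition enters the additional vertex, so it can only come first. The rows of the sinks
lead to state `0`, which is a vertex since there is at least one. -/
theorem TSPPInstance.chain_to_start (x : Fin (2 * (I.n + 1))) :
    I.chain x (startState I.n) = 0 := by
  have h1 : I.chain x (startState I.n) =
      (orderT (6 * I.size) I.n I.weights x (2 * I.n)).val := rfl
  have := I.n_pos
  rw [h1]
  rcases Nat.even_or_odd' (x : ℕ) with ⟨i, hi | hi⟩
  · rw [hi, orderT_even_two_mul, val_zeroFrac]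
  · rw [hi, orderT_odd, if_neg (by omega), val_zeroFrac]

theorem TSPPInstance.transProd_chain {a : Fin I.n} {l : List (Fin I.n)}
    (hc : (a :: l).IsChain I.G.Adj) :
    transProd I.chain (vertexState a) (l.map vertexState) =
      (l.map fun v : Fin I.n => 1 / (2 : ℚ) ^ ((v : ℕ) + 2)).prod *
        ((stepValues (edgeWeight fun e => (I.w e).val) a l).map
          (factor (2 ^ (6 * I.size)))).prod := by
  induction l generalizing a with
  | nil => simp [transProd, stepValues]
  | cons b l ih =>
    rw [List.isChain_cons_cons] at hc
    rw [List.map_cons, transProd, ih hc.2, I.chain_of_adj hc.1]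
    simp only [stepValues, List.map_cons, List.prod_cons]
    ring

theorem TSPPInstance.isChain_of_transProd_ne_zero {a : Fin I.n} {l : List (Fin I.n)}
    (h : transProd I.chain (vertexState a) (l.map vertexState) ≠ 0) :
    (a :: l).IsChain I.G.Adj := by
  have h1 := TSPPOrder.isChain_of_transProd_ne_zero h
  rw [← List.map_cons, List.isChain_map] at h1
  exact h1.imp fun i j hij => not_not.1 fun hn => hij (I.chain_of_not_adj hn)

theorem ne_zero_of_mem_of_transProd {S K : Type*} [Field K] {T : Matrix S S K} {a b : S}
    {l : List S} (h : transProd T a l ≠ 0) (hb : b ∈ l) : ∃ x, T x b ≠ 0 := by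
  induction l generalizing a with
  | nil => simp at hb
  | cons c l ih =>
    rw [transProd, mul_ne_zero_iff] at h
    rcases List.mem_cons.1 hb with rfl | hb
    · exact ⟨a, h.1⟩
    · exact ih h.2 hb

/-- The probability of an order that starts with the additional vertex and then follows a path. -/
theorem TSPPInstance.genProb_chain {a : Fin I.n} {l : List (Fin I.n)}
    (hp : (a :: l).Perm (List.finRange I.n)) (hc : (a :: l).IsChain I.G.Adj) :
    genProb I.chain (startState I.n :: (a :: l).map vertexState) =
      ((2 : ℚ) ^ expo I.n * (2 * (I.n + 1)))⁻¹ *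
        ((-I.C.val :: stepValues (edgeWeight fun e => (I.w e).val) a l).map
          (factor (2 ^ (6 * I.size)))).prod := by
  have h1 : ((a :: l).map fun v : Fin I.n => 1 / (2 : ℚ) ^ ((v : ℕ) + 2)).prod =
      1 / 2 ^ expo I.n := by
    rw [(hp.map _).prod_eq, ← Fin.prod_univ_def,
      Fin.prod_univ_eq_prod_range (fun v => 1 / (2 : ℚ) ^ (v + 2)), Finset.prod_div_distrib,
      Finset.prod_pow_eq_pow_sum, expo]
    simp
  rw [genProb, List.map_cons, transProd, I.transProd_chain hc, I.chain_start, Fintype.card_fin]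
  rw [List.map_cons, List.prod_cons] at h1
  rw [List.map_cons, List.prod_cons]
  have e : ∀ A B F Q : ℚ, A * F * (B * Q) = (A * B) * (F * Q) := by intros; ring
  rw [e, h1]
  push_cast
  field_simp

theorem val_threshold (n k : ℕ) :
    (threshold n k).val = ((2 : ℚ) ^ expo n * (2 * (n + 1)))⁻¹ * (1 - 1 / 2 ^ k) := by
  have h : ((2 ^ k - 1 : ℕ) : ℚ) = 2 ^ k - 1 := by
    rw [Nat.cast_sub Nat.one_le_two_pow]; simp
  rw [threshold, Frac.val, thresholdDen]
  simp only [PNat.mk_coe, Int.cast_natCast, h]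
  push_cast
  field_simp

theorem TSPPInstance.threshold_le_iff {a : Fin I.n} {l : List (Fin I.n)}
    (hp : (a :: l).Perm (List.finRange I.n)) (hc : (a :: l).IsChain I.G.Adj) :
    (threshold I.n (8 * I.size)).val ≤
        genProb I.chain (startState I.n :: (a :: l).map vertexState) ↔
      (stepValues (edgeWeight fun e => (I.w e).val) a l).sum ≤ I.C.val := by
  have hs := I.size_eq
  have hn := I.n_pos
  have hH : (4 : ℚ) ≤ 2 ^ I.size := by
    have : (2 : ℚ) ^ 2 ≤ 2 ^ I.size := pow_le_pow_right₀ (by norm_num) (by omega)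
    linarith
  have hlen := hp.length_eq
  rw [List.length_cons, List.length_finRange] at hlen
  have hb := I.weight_bounds hc
  have key := le_prod_factor_iff hH
    (-I.C.val :: stepValues (edgeWeight fun e => (I.w e).val) a l) (by
      rw [List.length_cons, length_stepValues, hlen]
      have : I.n < 2 ^ I.size := lt_of_le_of_lt (by omega) Nat.lt_two_pow_self
      exact_mod_cast this.le)
    (fun x hx => (hb x hx).1) I.commonDen_pos (by exact_mod_cast I.commonDen_le)
    (fun x hx => (hb x hx).2)
  rw [I.genProb_chain hp hc, val_threshold, mul_le_mul_iff_of_pos_left (by positivity)]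
  rw [← pow_mul, ← pow_mul, mul_comm I.size 8, mul_comm I.size 6, List.sum_cons,
    neg_add_nonpos_iff] at key
  exact key

/-- In an order of positive probability the additional vertex comes first, and the other states
form a Hamiltonian path. -/
theorem TSPPInstance.yes_iff : TSPP.Yes I ↔ ORDER.Yes I.toOrder := by
  have hfin : (Finset.univ : Finset (Fin I.n)).toList.Perm (List.finRange I.n) := by
    rw [List.perm_iff_count]
    intro a
    rw [List.count_eq_one_of_mem (Finset.nodup_toList _) (by simp),
      List.count_eq_one_of_mem (List.nodup_finRange _) (by simp)]
  have hpos : 0 < (threshold I.n (8 * I.size)).val := by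
    have hs := I.size_eq
    rw [val_threshold]
    have : (1 : ℚ) / 2 ^ (8 * I.size) < 1 := by
      rw [div_lt_one (by positivity)]
      exact one_lt_pow₀ (by norm_num) (by omega)
    have : 0 < 1 - (1 : ℚ) / 2 ^ (8 * I.size) := by linarith
    positivity
  have h1 : TSPP.Yes I ↔ HasHamiltonianPath (fun e => (I.w e).val) I.C.val := Iff.rfl
  have h2 : ORDER.Yes I.toOrder ↔ HasOrder I.chain
    ((List.finRange I.n).map vertexState ++ [startState I.n])
    (threshold I.n (8 * I.size)).val := Iff.rfl
  rw [h1, h2, hasHamiltonianPath_iff]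
  constructor
  · rintro ⟨a, l, hp, hc, hw⟩
    have hp' := hp.trans hfin
    refine ⟨startState I.n :: (a :: l).map vertexState, ?_, (I.threshold_le_iff hp' hc).2 hw⟩
    exact ((hp'.map _).cons _).trans (List.perm_append_singleton _ _).symm
  · rintro ⟨Y, hp, hY⟩
    have hp2 := hp.trans (List.perm_append_singleton _ _)
    cases Y with
    | nil => simpa using hp2.length_eq
    | cons y Y =>
      have hne : transProd I.chain y Y ≠ 0 := by
        intro h0
        rw [genProb, h0, mul_zero] at hY
        linarith
      have hy : y = startState I.n := by
        by_contra hy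
        have hmem : startState I.n ∈ y :: Y := hp2.mem_iff.2 (by simp)
        rcases List.mem_cons.1 hmem with h | h
        · exact hy h.symm
        · obtain ⟨x, hx⟩ := ne_zero_of_mem_of_transProd hne h
          exact hx (I.chain_to_start x)
      subst hy
      have hp3 := hp2.cons_inv
      obtain ⟨l, hl, rfl⟩ : ∃ l : List (Fin I.n), l.Perm (List.finRange I.n) ∧
          l.map vertexState = Y := by
        have h := hp3
        have h4 : ∀ y ∈ Y, ∃ v, vertexState (n := I.n) v = y := by
          intro y hy
          have := hp3.mem_iff.1 hy
          simpa using this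
        have hinj : Function.Injective (vertexState (n := I.n)) := by
          intro v v' h
          have := congrArg Fin.val h
          simp only [vertexState] at this
          exact Fin.ext (by omega)
        obtain ⟨l, rfl⟩ : Y ∈ Set.range (List.map (vertexState (n := I.n))) := by
          rw [Set.range_list_map]
          exact fun y hy => h4 y hy
        exact ⟨l, (List.map_perm_map_iff hinj).1 hp3, rfl⟩
      cases l with
      | nil =>
        have := hl.length_eq
        have := I.n_pos
        simp at *
        omega
      | cons a l =>
        have hc : (a :: l).IsChain I.G.Adj := by
          rw [List.map_cons, transProd, mul_ne_zero_iff] at hne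
          exact I.isChain_of_transProd_ne_zero hne.2
        exact ⟨a, l, hl.trans hfin.symm, hc, (I.threshold_le_iff hl hc).1 hY⟩

/-- The path problem reduces to the ordering problem in polynomial time. -/
theorem polyTimeReducible_TSPP_ORDER : PolyTimeReducible TSPP ORDER := by
  refine ⟨TSPPInstance.toOrder, ?_, fun I => I.yes_iff⟩
  obtain ⟨P, hP⟩ := exists_run_reduction
  refine polyTime_of_run .reduction .inp .out P fun I => ?_
  have h := hP I.n I.weights I.C I.encode I.encode_eq ?_ ?_ ?_
  · have e : ORDER.encode (TSPPInstance.toOrder I) =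
      outWord (6 * I.encode.length) (8 * I.encode.length) I.n I.weights I.C := I.encode_toOrder
    rw [e]
    exact h
  · intro i hi j hj q hq
    have h1 := I.length_weight_le ⟨i, hi⟩ ⟨j, hj⟩
    rw [← I.weights_coe, Option.mem_def.1 hq, encOptFrac, length_encFrac] at h1
    have h2 : I.size = I.encode.length := rfl
    omega
  all_goals
    have h1 := I.size_eq
    have h2 : I.size = I.encode.length := rfl
    rw [length_encFrac] at h1
    omega

end

end TSPPOrder

end

open TSPPOrder in
theorem mainTheorem3 :
    PolyTimeReducible TSPP ORDER ∧
      ∀ (V : Type*) [Fintype V] [DecidableEq V] [Nonempty V] (G : SimpleGraph V)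
        (w : G.edgeSet → ℝ) (C : ℝ), (1 < Fintype.card V → G ≠ ⊥) →
          expChain w ∈ Matrix.rowStochastic ℝ V ∧
            (HasHamiltonianPath w C ↔
              HasOrder (expChain w) Finset.univ.toList (expThreshold w C)) :=
  ⟨polyTimeReducible_TSPP_ORDER, fun _ _ _ _ _ w C hG =>
    ⟨expChain_mem_rowStochastic w, hasHamiltonianPath_iff_hasOrder w C hG⟩⟩
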